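/- For $m\in(0,1)\cup(1,+\infty)$ and $p>0$ let $g_1(p,m)=\cos\frac pm\,\sin p-m\cos p\,\sin\frac pm$. Then, for every $m\in(0,1)\cup(1,+\infty)$, the function $p\mapsto g_1(p,m)$ has a minimal positive root $p_1(m)$; it satisfies $p_1(m)=m\,p_1(1/m)$ and has the following properties, where $\mathbb N=\{1,2,\dots\}$. (a) $p_1$ is continuous and strictly increasing on $(0,1)$ and equals $\frac{\pi m}{1-m}$ at $m=\frac{k}{k+2}$, $k\in\mathbb N$; it is continuous and strictly decreasing on $(1,+\infty)$ and equals $\frac{\pi m}{m-1}$ at $m=\frac{k+2}{k}$, $k\in\mathbb N$. (b) $p_1$ is continuously differentiable (in a neighbourhood of $m$) at every $m\in(0,1)$ except the points $m=\frac{k}{k+1}$, $k\in\mathbb N$, where its derivative (the limit of difference quotients) is $+\infty$; and at every $m\in(1,+\infty)$ except the points $m=\frac{k+1}{k}$, $k\in\mathbb N$, where its derivative is $-\infty$. (c) For every $k\in\mathbb N$: $p_1(m)<\frac{\pi m}{1-m}$ for $m\in\left(\frac{2k-1}{2k+1},\frac{k}{k+1}\right)$; $\frac{\pi m}{1-m}<p_1(m)$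 for $m\in\left(\frac{k}{k+1},\frac{2k+1}{2k+3}\right)$; $\frac{\pi m}{m-1}<p_1(m)$ for $m\in\left(\frac{2k+3}{2k+1},\frac{k+1}{k}\right)$; $p_1(m)<\frac{\pi m}{m-1}$ for $m\in\left(\frac{k+1}{k},\frac{2k+1}{2k-1}\right)$. (d) For $k\in\mathbb N$ define $$h_1(m)=\min\left(\tfrac{1+m}{2(1-m)}-k,\ \sqrt[3]{2k+1-\tfrac{1+m}{1-m}},\ \tfrac{1+m}{\pi(1-m)}\arcsin\tfrac{1-m}{1+m}\right),\quad m\in\left(\tfrac{2k-1}{2k+1},\tfrac{k}{k+1}\right),$$ $$h_2(m)=\min\left(\sqrt[3]{\tfrac{1+m}{1-m}-(2k+1)},\ k+1-\tfrac{1+m}{2(1-m)},\ \tfrac{1+m}{\pi(1-m)}\arcsin\tfrac{1-m}{1+m}\right),\quad m\in\left(\tfrac{k}{k+1},\tfrac{2k+1}{2k+3}\right).$$ Then, for every $k\in\mathbb N$: $\frac{\pi m}{1-m}-\frac{\pi m}{1+m}h_1(m)\le p_1(m)$ for $m\in\left(\frac{2k-1}{2k+1},\frac{k}{k+1}\right)$;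 $p_1(m)\le\frac{\pi m}{1-m}+\frac{\pi m}{1+m}h_2(m)$ for $m\in\left(\frac{k}{k+1},\frac{2k+1}{2k+3}\right)$; $p_1(m)\le\frac{\pi m}{m-1}+\frac{\pi m}{1+m}h_2\left(\frac1m\right)$ for $m\in\left(\frac{2k+3}{2k+1},\frac{k+1}{k}\right)$; $\frac{\pi m}{m-1}-\frac{\pi m}{1+m}h_1\left(\frac1m\right)\le p_1(m)$ for $m\in\left(\frac{k+1}{k},\frac{2k+1}{2k-1}\right)$. In each of these intervals equality holds at exactly one point $m$; the inequality is strict at all other points. (e) The equation $\tan x=x$ has exactly one root $\rho=4.493409\dots$ in $\left(\pi,\frac{3\pi}{2}\right)$, and $\max\left\{\rho m,\frac{\pi m}{1-m}\right\}<p_1(m)<\frac{3\pi m}{2}$ for $0<m<\frac13$; $\max\left\{\rho,\frac{\pi m}{m-1}\right\}<p_1(m)<\frac{3\pi}{2}$ for $m>3$. (f) For every $m\in(0,1)\cup(1,+\infty)$ the function $p\mapsto g_1(p,m)$ changes its sign at $p=p_1(m)$: near this point it is nonzero on each side and has opposite signs on the two sides. -/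

import Mathlib

open Set Filter Topology

noncomputable section

/-- `g₁(p, m) = cos (p/m) sin p - m cos p sin (p/m)`. -/
def g₁ (p m : ℝ) : ℝ :=
  Real.cos (p / m) * Real.sin p - m * Real.cos p * Real.sin (p / m)

/-- The set of positive roots of `p ↦ g₁(p, m)`. -/
def posRoots (m : ℝ) : Set ℝ := {p : ℝ | 0 < p ∧ g₁ p m = 0}

/-- The minimal positive root of `p ↦ g₁(p, m)`, as the infimum of the set of positive roots. -/
def p₁ (m : ℝ) : ℝ := sInf (posRoots m)

/-- The correction term on the interval `((2k-1)/(2k+1), k/(k+1))`; the base of the cube root is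
positive there. -/
def h₁ (k : ℕ) (m : ℝ) : ℝ :=
  min ((1 + m) / (2 * (1 - m)) - k)
    (min ((2 * (k : ℝ) + 1 - (1 + m) / (1 - m)) ^ ((1 : ℝ) / 3))
      ((1 + m) / (Real.pi * (1 - m)) * Real.arcsin ((1 - m) / (1 + m))))

/-- The correction term on the interval `(k/(k+1), (2k+1)/(2k+3))`; the base of the cube root is
positive there. -/
def h₂ (k : ℕ) (m : ℝ) : ℝ :=
  min (((1 + m) / (1 - m) - (2 * (k : ℝ) + 1)) ^ ((1 : ℝ) / 3))
    (min ((k : ℝ) + 1 - (1 + m) / (2 * (1 - m)))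
      ((1 + m) / (Real.pi * (1 - m)) * Real.arcsin ((1 - m) / (1 + m))))

/-- `f` changes its sign at `x`: it has strict and opposite signs on a left and on a right
punctured neighbourhood of `x`. -/
def ChangesSignAt (f : ℝ → ℝ) (x : ℝ) : Prop :=
  ∃ ε : ℝ, 0 < ε ∧
    (((∀ u ∈ Ioo (x - ε) x, f u < 0) ∧ (∀ v ∈ Ioo x (x + ε), 0 < f v)) ∨
     ((∀ u ∈ Ioo (x - ε) x, 0 < f u) ∧ (∀ v ∈ Ioo x (x + ε), f v < 0)))

end

/-! With `p = m x` the equation becomes `rootFn x m = 0`, and `g₁ p m = -m * rootFn p (1 / m)`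
reduces `m > 1` to `m < 1`. For `m < 1` everything rests on a rigidity fact: at a zero of `rootFn ·
m` with `π/2 < (1 - m) x < 3π/2`, the sum form `two_mul_rootFn` gives `|sin ((1 - m) x)| ≤ |sin ((1
+ m) x)|`, which forces `sin x * sin (m x) ≤ 0`. As the `x`-derivative is `(m² - 1) sin x sin (m
x)`, every such zero is an up-crossing (`rootFn_upcrossing`), including the degenerate ones where
both sines vanish. The function is negative before this window and positive at its right end, so the
window holds exactly one zero, which is the minimal positive one (`exists_root`).

The sign of `rootFn` at a test point therefore tells on which side the root `xRoot m` lies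
(`lt_xRoot_of_neg`, `xRoot_lt_of_pos`), and all estimates come from choosing test points. Points on
lines through `(m, xRoot m)` give monotonicity, and infinite slope at degenerate zeros
(`xRoot_line`); the implicit function theorem gives smoothness elsewhere. The point `π / (1 - m)`
gives (c), since the sign there is that of `sin (a π)` with `a = (1 + m) / (1 - m)`. Points at
distance `π δ / (1 + m)` from it give (d) (`offset_bounds`); equality there becomes a trigonometric
equation in `arcsin (1 / a)` with one solution. The points `ρ` and `3π/2` give (e). -/

/-! ### The reduced function and its sum form. -/

/-- `cos x sin (m x) - m cos (m x) sin x`, which is `g₁ (m x) m` for `m ≠ 0`. -/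
noncomputable def rootFn (x m : ℝ) : ℝ :=
  Real.cos x * Real.sin (m * x) - m * Real.cos (m * x) * Real.sin x

lemma g₁_mul_self {m : ℝ} (hm : m ≠ 0) (x : ℝ) : g₁ (m * x) m = rootFn x m := by
  unfold g₁ rootFn
  rw [mul_div_cancel_left₀ x hm]

lemma two_mul_rootFn (x m : ℝ) :
    2 * rootFn x m = (1 - m) * Real.sin ((1 + m) * x) - (1 + m) * Real.sin ((1 - m) * x) := by
  unfold rootFn
  rw [show (1 + m) * x = x + m * x by ring, show (1 - m) * x = x - m * x by ring,
    Real.sin_add, Real.sin_sub]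
  ring

lemma sin_mul_sin_eq (x m : ℝ) :
    2 * (Real.sin x * Real.sin (m * x)) =
      Real.cos ((1 - m) * x) - Real.cos ((1 + m) * x) := by
  rw [show (1 + m) * x = x + m * x by ring, show (1 - m) * x = x - m * x by ring,
    Real.cos_add, Real.cos_sub]
  ring

/-- Strict concavity of the sine along the chord from `0` to `v`: `sin t / t` decreases on `(0, π]`.
-/
lemma mul_sin_lt_mul_sin {u v : ℝ} (hu : 0 < u) (huv : u < v) (hv : v ≤ Real.pi) :
    u * Real.sin v < v * Real.sin u := by
  have hvpos : 0 < v := hu.trans huv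
  have h := strictConcaveOn_sin_Icc.2 (show (0:ℝ) ∈ Icc 0 Real.pi from ⟨le_rfl, Real.pi_pos.le⟩)
    (show v ∈ Icc 0 Real.pi from ⟨hvpos.le, hv⟩) hvpos.ne
    (show 0 < 1 - u / v by rw [sub_pos, div_lt_one hvpos]; exact huv)
    (show 0 < u / v by positivity) (by ring)
  simp only [smul_eq_mul, mul_zero, Real.sin_zero, zero_add] at h
  rw [div_mul_cancel₀ u hvpos.ne', div_mul_eq_mul_div, div_lt_iff₀ hvpos] at h
  linarith

lemma hasDerivAt_rootFn_left (x m : ℝ) :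
    HasDerivAt (fun y => rootFn y m) ((m ^ 2 - 1) * (Real.sin x * Real.sin (m * x))) x := by
  have hl : HasDerivAt (fun y : ℝ => m * y) m x := by
    simpa using (hasDerivAt_id x).const_mul m
  have h := ((Real.hasDerivAt_cos x).mul hl.sin).sub
    ((hl.cos.const_mul m).mul (Real.hasDerivAt_sin x))
  refine h.congr_deriv ?_
  ring

/-! ### Zeros in the window: up-crossings, hence uniqueness. -/

/-- At a zero of `rootFn` with `(1 - m) x` between `π / 2` and `3 π / 2`, either the `x`-derivative
is positive or both sines vanish. -/
lemma sin_mul_sin_of_rootFn_eq_zero {x m : ℝ} (hm : m ∈ Ioo (0 : ℝ) 1)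
    (hx1 : Real.pi / 2 < (1 - m) * x) (hx2 : (1 - m) * x < 3 * Real.pi / 2)
    (h : rootFn x m = 0) :
    Real.sin x * Real.sin (m * x) < 0 ∨ (Real.sin x = 0 ∧ Real.sin (m * x) = 0) := by
  obtain ⟨h0, h1⟩ := hm
  have hcos : Real.cos ((1 - m) * x) < 0 :=
    Real.cos_neg_of_pi_div_two_lt_of_lt hx1 (by linarith)
  have e1 := two_mul_rootFn x m
  rw [h] at e1
  have e2 := sin_mul_sin_eq x m
  have s1 := Real.sin_sq_add_cos_sq ((1 - m) * x)
  have s2 := Real.sin_sq_add_cos_sq ((1 + m) * x)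
  have c1 := Real.sin_sq_add_cos_sq x
  have c2 := Real.sin_sq_add_cos_sq (m * x)
  set A := Real.sin ((1 - m) * x)
  set B := Real.sin ((1 + m) * x)
  set C := Real.cos ((1 - m) * x)
  set D := Real.cos ((1 + m) * x)
  -- At a zero `(1 - m) B = (1 + m) A`, so `|A| ≤ |B|` and hence `|D| ≤ |C|`. With `C < 0` this
  -- gives `C ≤ D`, and `C - D` is twice the product of the sines.
  have hAB : A ^ 2 ≤ B ^ 2 := by
    have h1m : (0:ℝ) < 1 - m := by linarith
    have : (1 - m) ^ 2 * B ^ 2 = (1 + m) ^ 2 * A ^ 2 := by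
      have : (1 - m) * B = (1 + m) * A := by linarith
      calc (1 - m) ^ 2 * B ^ 2 = ((1 - m) * B) ^ 2 := by ring
        _ = _ := by rw [this]; ring
    have h3 : (1 - m) ^ 2 * A ^ 2 ≤ (1 - m) ^ 2 * B ^ 2 := by
      rw [this]; gcongr; linarith
    exact le_of_mul_le_mul_left h3 (by positivity)
  have hCD : |D| ≤ |C| := by
    rw [← sq_le_sq]; linarith
  rw [abs_of_neg hcos] at hCD
  have hle : C ≤ D := by
    have := neg_abs_le D; linarith
  rcases hle.lt_or_eq with hlt | heq
  · left; linarith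
  · right
    unfold rootFn at h
    have hz : Real.sin x * Real.sin (m * x) = 0 := by linarith
    rcases mul_eq_zero.1 hz with h5 | h5
    · refine ⟨h5, ?_⟩
      rw [h5] at h c1
      have : Real.cos x ≠ 0 := by
        intro h6; rw [h6] at c1; norm_num at c1
      simpa [this] using h
    · refine ⟨?_, h5⟩
      rw [h5] at h c2
      have : Real.cos (m * x) ≠ 0 := by
        intro h6; rw [h6] at c2; norm_num at c2
      simpa [this, h0.ne'] using h

lemma HasDerivAt.eventually_gt_lt {f : ℝ → ℝ} {f' a : ℝ} (h : HasDerivAt f f' a) (hf : 0 < f') :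
    (∀ᶠ y in 𝓝[>] a, f a < f y) ∧ (∀ᶠ y in 𝓝[<] a, f y < f a) := by
  have ht := (hasDerivAt_iff_tendsto_slope.1 h).eventually (lt_mem_nhds hf)
  constructor
  · have h2 := ht.filter_mono (nhdsWithin_mono a (fun y (hy : a < y) => ne_of_gt hy))
    filter_upwards [h2, self_mem_nhdsWithin] with y hy hay
    have hay' : 0 < y - a := sub_pos.2 hay
    rw [slope_def_field, lt_div_iff₀ hay'] at hy
    linarith
  · have h2 := ht.filter_mono (nhdsWithin_mono a (fun y (hy : y < a) => ne_of_lt hy))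
    filter_upwards [h2, self_mem_nhdsWithin] with y hy hay
    have hay' : y - a < 0 := sub_neg.2 hay
    rw [slope_def_field, lt_div_iff_of_neg hay'] at hy
    linarith

/-- At a zero where both sines vanish the derivative vanishes too. There `(1 ± m) x` are odd
multiples of `π`, so shifting by `x` only changes the sign of the function, and its behaviour is
read off near `0`. -/
lemma rootFn_add_of_double_zero {x m s : ℝ} (h1 : Real.sin x = 0) (h2 : Real.sin (m * x) = 0)
    (h3 : Real.cos ((1 - m) * x) < 0) :
    2 * rootFn (x + s) m =
      (1 + m) * Real.sin ((1 - m) * s) - (1 - m) * Real.sin ((1 + m) * s) := by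
  have hA : Real.sin ((1 - m) * x) = 0 := by
    rw [show (1 - m) * x = x - m * x by ring, Real.sin_sub, h1, h2]; ring
  have hB : Real.sin ((1 + m) * x) = 0 := by
    rw [show (1 + m) * x = x + m * x by ring, Real.sin_add, h1, h2]; ring
  have hC : Real.cos ((1 - m) * x) = -1 := by
    rcases (Real.sin_eq_zero_iff_cos_eq).1 hA with h | h
    · linarith
    · exact h
  have hD : Real.cos ((1 + m) * x) = -1 := by
    have := sin_mul_sin_eq x m
    rw [h1, hC] at this; linarith
  rw [two_mul_rootFn, mul_add, mul_add, Real.sin_add, Real.sin_add, hA, hB, hC, hD]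
  ring

/-- Every zero of `rootFn · m` in the window is a strict up-crossing. -/
lemma rootFn_upcrossing {x m : ℝ} (hm : m ∈ Ioo (0 : ℝ) 1)
    (hx1 : Real.pi / 2 < (1 - m) * x) (hx2 : (1 - m) * x < 3 * Real.pi / 2)
    (h : rootFn x m = 0) :
    (∀ᶠ y in 𝓝[>] x, 0 < rootFn y m) ∧ (∀ᶠ y in 𝓝[<] x, rootFn y m < 0) := by
  rcases sin_mul_sin_of_rootFn_eq_zero hm hx1 hx2 h with hs | ⟨hs1, hs2⟩
  · have hd := (hasDerivAt_rootFn_left x m).eventually_gt_lt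
      (mul_pos_of_neg_of_neg (by nlinarith [hm.1, hm.2]) hs)
    simpa only [h] using hd
  · have hcos : Real.cos ((1 - m) * x) < 0 :=
      Real.cos_neg_of_pi_div_two_lt_of_lt hx1 (by linarith)
    obtain ⟨h0, h1⟩ := hm
    -- The bound `s < 1` keeps `(1 + m) s` below `2 < π`, within the range of concavity.
    have key : ∀ s : ℝ, 0 < s → s < 1 →
        (1 - m) * Real.sin ((1 + m) * s) < (1 + m) * Real.sin ((1 - m) * s) := by
      intro s hs hs1
      have := mul_sin_lt_mul_sin (u := (1 - m) * s) (v := (1 + m) * s)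
        (mul_pos (by linarith) hs) (by nlinarith) (by nlinarith [Real.pi_gt_three])
      exact lt_of_mul_lt_mul_right (a := s) (by linarith) hs.le
    constructor
    · filter_upwards [Ioo_mem_nhdsGT (show x < x + 1 by linarith)] with y hy
      have e := rootFn_add_of_double_zero (s := y - x) hs1 hs2 hcos
      rw [add_sub_cancel] at e
      have := key (y - x) (by linarith [hy.1]) (by linarith [hy.2])
      linarith
    · filter_upwards [Ioo_mem_nhdsLT (show x - 1 < x by linarith)] with y hy
      have e := rootFn_add_of_double_zero (s := -(x - y)) hs1 hs2 hcos
      rw [show x + -(x - y) = y by ring, mul_neg, mul_neg, Real.sin_neg, Real.sin_neg] at e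
      have := key (x - y) (by linarith [hy.2]) (by linarith [hy.1])
      linarith

lemma rootFn_neg_of_le {x m : ℝ} (hm : m ∈ Ioo (0 : ℝ) 1) (hx : 0 < x)
    (hx1 : (1 - m) * x ≤ Real.pi / 2) : rootFn x m < 0 := by
  obtain ⟨h0, h1⟩ := hm
  have hpi := Real.pi_pos
  have e := two_mul_rootFn x m
  rcases le_or_gt ((1 + m) * x) (Real.pi / 2) with h | h
  · have := mul_sin_lt_mul_sin (u := (1 - m) * x) (v := (1 + m) * x)
      (mul_pos (by linarith) hx) (by nlinarith) (by linarith)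
    have : (1 - m) * Real.sin ((1 + m) * x) < (1 + m) * Real.sin ((1 - m) * x) :=
      lt_of_mul_lt_mul_right (a := x) (by linarith) hx.le
    linarith
  · have hm1 : 0 < 1 + m := by linarith
    have hlt : (1 - m) * (Real.pi / 2) < (1 + m) * (Real.pi / 2) := by nlinarith
    -- This is the value of `(1 - m) x` when `(1 + m) x = π / 2`. Beyond it `sin ((1 - m) x)`
    -- exceeds `(1 - m) / (1 + m)`, while `sin ((1 + m) x) ≤ 1`.
    have hu : 0 < (1 - m) * (Real.pi / 2) / (1 + m) :=
      div_pos (mul_pos (by linarith) (by linarith)) hm1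
    have h2 : (1 - m) * (Real.pi / 2) / (1 + m) < (1 - m) * x := by
      rw [div_lt_iff₀ hm1]; nlinarith
    have h3 := mul_sin_lt_mul_sin (u := (1 - m) * (Real.pi / 2) / (1 + m)) (v := Real.pi / 2)
      hu (by rw [div_lt_iff₀ hm1]; linarith) (by linarith)
    rw [Real.sin_pi_div_two] at h3
    have h4 : (1 - m) < (1 + m) * Real.sin ((1 - m) * (Real.pi / 2) / (1 + m)) := by
      have h5 : (1 - m) * (Real.pi / 2) / (1 + m) * (1 + m) = (1 - m) * (Real.pi / 2) :=
        div_mul_cancel₀ _ hm1.ne'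
      have h6 := mul_lt_mul_of_pos_right h3 hm1
      rw [mul_one, h5] at h6
      refine lt_of_mul_lt_mul_right (a := Real.pi / 2) ?_ (by linarith)
      linarith
    have h5 := Real.sin_lt_sin_of_lt_of_le_pi_div_two (by linarith) hx1 h2
    have h6 := mul_lt_mul_of_pos_left h5 hm1
    have h7 := mul_le_mul_of_nonneg_left (Real.sin_le_one ((1 + m) * x)) (by linarith : 0 ≤ 1 - m)
    linarith

/-- The root is the least zero in the window. Up-crossings keep the function nonnegative after it,
and a second zero would have to be approached from the left through negative values. -/
theorem exists_root {m : ℝ} (hm : m ∈ Ioo (0 : ℝ) 1) :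
    ∃ x : ℝ, (Real.pi / 2 < (1 - m) * x ∧ (1 - m) * x < 3 * Real.pi / 2) ∧ rootFn x m = 0 ∧
      (∀ y, 0 < y → y < x → rootFn y m < 0) ∧
      (∀ y, x < y → (1 - m) * y ≤ 3 * Real.pi / 2 → 0 < rootFn y m) := by
  have h0 := hm.1
  have h1 := hm.2
  have hpi := Real.pi_pos
  have h1m : 0 < 1 - m := by linarith
  have hc : Continuous fun y => rootFn y m := by
    unfold rootFn; fun_prop
  set a := Real.pi / 2 / (1 - m) with ha
  set b := 3 * Real.pi / 2 / (1 - m) with hb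
  have ha' : (1 - m) * a = Real.pi / 2 := by rw [ha]; field_simp
  have hb' : (1 - m) * b = 3 * Real.pi / 2 := by rw [hb]; field_simp
  have ha0 : 0 < a := by positivity
  have hab : a < b := by rw [ha, hb]; gcongr; linarith
  have hfa : rootFn a m < 0 := rootFn_neg_of_le hm ha0 ha'.le
  have hfb : 0 < rootFn b m := by
    have e := two_mul_rootFn b m
    rw [hb', show 3 * Real.pi / 2 = Real.pi / 2 + Real.pi by ring, Real.sin_add_pi,
      Real.sin_pi_div_two] at e
    nlinarith [Real.neg_one_le_sin ((1 + m) * b)]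
  set S := {y | y ∈ Icc a b ∧ rootFn y m = 0} with hS
  have hScl : IsClosed S := isClosed_Icc.inter (isClosed_eq hc continuous_const)
  have hSne : S.Nonempty := by
    obtain ⟨y, hy, hy2⟩ := intermediate_value_Icc hab.le hc.continuousOn
      (show (0:ℝ) ∈ Icc (rootFn a m) (rootFn b m) from ⟨hfa.le, hfb.le⟩)
    exact ⟨y, hy, hy2⟩
  have hSbd : BddBelow S := ⟨a, fun y hy => hy.1.1⟩
  obtain ⟨hxI, hx0⟩ : sInf S ∈ S := hScl.csInf_mem hSne hSbd
  have hmin : ∀ y ∈ S, sInf S ≤ y := fun y hy => csInf_le hSbd hy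
  generalize sInf S = x at hxI hx0 hmin
  have win : ∀ y, y ∈ Icc a b → rootFn y m = 0 →
      Real.pi / 2 < (1 - m) * y ∧ (1 - m) * y < 3 * Real.pi / 2 := by
    intro y hy hy0
    constructor
    · rw [← ha']
      refine mul_lt_mul_of_pos_left (lt_of_le_of_ne hy.1 ?_) h1m
      rintro rfl; linarith
    · rw [← hb']
      refine mul_lt_mul_of_pos_left (lt_of_le_of_ne hy.2 ?_) h1m
      rintro rfl; linarith
  refine ⟨x, win x hxI hx0, hx0, ?_, ?_⟩
  · intro y hy hyx
    rcases le_or_gt y a with h | h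
    · exact rootFn_neg_of_le hm hy (by rw [← ha']; gcongr)
    · by_contra hcon
      push Not at hcon
      obtain ⟨z, hz, hz2⟩ := intermediate_value_Icc h.le hc.continuousOn
        (show (0:ℝ) ∈ Icc (rootFn a m) (rootFn y m) from ⟨hfa.le, hcon⟩)
      have := hmin z ⟨⟨hz.1, by linarith [hz.2, hxI.2]⟩, hz2⟩
      linarith [hz.2]
  · have hsub : Icc x b ⊆ {y | 0 ≤ rootFn y m} := by
      apply IsClosed.Icc_subset_of_forall_exists_gt
      · exact (isClosed_le continuous_const hc).inter isClosed_Icc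
      · exact hx0.ge
      · rintro y ⟨hy0, hyx, hyb⟩ z hz
        have hev : ∀ᶠ w in 𝓝[>] y, 0 ≤ rootFn w m := by
          rcases (show 0 ≤ rootFn y m from hy0).lt_or_eq with h | h
          · have : ∀ᶠ w in 𝓝 y, 0 < rootFn w m := hc.continuousAt.eventually (lt_mem_nhds h)
            exact (this.filter_mono nhdsWithin_le_nhds).mono fun w hw => hw.le
          · have hw := win y ⟨hxI.1.trans hyx, hyb.le⟩ h.symm
            exact (rootFn_upcrossing hm hw.1 hw.2 h.symm).1.mono fun w hw => hw.le
        obtain ⟨w, hw1, hw2⟩ := (hev.and (Ioo_mem_nhdsGT (show y < z from hz))).exists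
        exact ⟨w, hw1, hw2.1, hw2.2.le⟩
    intro y hxy hy
    have hyb : y ≤ b := by
      rw [← hb'] at hy; exact le_of_mul_le_mul_left hy h1m
    refine lt_of_le_of_ne (hsub ⟨hxy.le, hyb⟩) fun hy0 => ?_
    have hw := win y ⟨hxI.1.trans hxy.le, hyb⟩ hy0.symm
    obtain ⟨w, hw1, hw2⟩ := ((rootFn_upcrossing hm hw.1 hw.2 hy0.symm).2.and
      (Ioo_mem_nhdsLT hxy)).exists
    have : 0 ≤ rootFn w m := hsub ⟨hw2.1.le, by linarith [hw2.2]⟩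
    linarith

/-! ### The root as a function of `m`: location by sign, continuity. -/

open Classical in
/-- For `m ∈ (0, 1)`, the minimal positive zero of `rootFn · m`. -/
noncomputable def xRoot (m : ℝ) : ℝ :=
  if hm : m ∈ Ioo (0 : ℝ) 1 then (exists_root hm).choose else 0

lemma xRoot_spec {m : ℝ} (hm : m ∈ Ioo (0 : ℝ) 1) :
    (Real.pi / 2 < (1 - m) * xRoot m ∧ (1 - m) * xRoot m < 3 * Real.pi / 2) ∧
      rootFn (xRoot m) m = 0 ∧
      (∀ y, 0 < y → y < xRoot m → rootFn y m < 0) ∧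
      (∀ y, xRoot m < y → (1 - m) * y ≤ 3 * Real.pi / 2 → 0 < rootFn y m) := by
  unfold xRoot
  rw [dif_pos hm]
  exact (exists_root hm).choose_spec

lemma xRoot_pos {m : ℝ} (hm : m ∈ Ioo (0 : ℝ) 1) : 0 < xRoot m := by
  have h := (xRoot_spec hm).1.1
  have hpi := Real.pi_pos
  exact pos_of_mul_pos_right (a := 1 - m) (by linarith) (by linarith [hm.2])

/-- The window bound on `y` is needed here because positivity to the right of the root is known only
up to the end of the window; `xRoot_lt_of_pos` needs no such bound. -/
lemma lt_xRoot_of_neg {m y : ℝ} (hm : m ∈ Ioo (0 : ℝ) 1) (hy : (1 - m) * y ≤ 3 * Real.pi / 2)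
    (h : rootFn y m < 0) : y < xRoot m := by
  obtain ⟨-, h0, -, h2⟩ := xRoot_spec hm
  rcases lt_trichotomy y (xRoot m) with h' | h' | h'
  · exact h'
  · rw [h', h0] at h; exact absurd h (lt_irrefl _)
  · exact absurd (h2 y h' hy) h.not_gt

lemma xRoot_lt_of_pos {m y : ℝ} (hm : m ∈ Ioo (0 : ℝ) 1) (hy : 0 < y)
    (h : 0 < rootFn y m) : xRoot m < y := by
  obtain ⟨-, h0, h2, -⟩ := xRoot_spec hm
  rcases lt_trichotomy y (xRoot m) with h' | h' | h'
  · exact absurd (h2 y hy h') h.not_gt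
  · rw [h', h0] at h; exact absurd h (lt_irrefl _)
  · exact h'

lemma xRoot_eq_of_eq_zero {m y : ℝ} (hm : m ∈ Ioo (0 : ℝ) 1) (hy : 0 < y)
    (hy2 : (1 - m) * y ≤ 3 * Real.pi / 2) (h : rootFn y m = 0) : xRoot m = y := by
  obtain ⟨-, h0, h2, h3⟩ := xRoot_spec hm
  rcases lt_trichotomy y (xRoot m) with h' | h' | h'
  · exact absurd (h2 y hy h') h.not_lt
  · exact h'.symm
  · exact absurd (h3 y h' hy2) h.not_gt

lemma xRoot_le_of_eq_zero {m y : ℝ} (hm : m ∈ Ioo (0 : ℝ) 1) (hy : 0 < y)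
    (h : rootFn y m = 0) : xRoot m ≤ y := by
  by_contra! h'
  exact absurd ((xRoot_spec hm).2.2.1 y hy h') h.not_lt

/-- The sign of `rootFn z` at a fixed `z` slightly to one side of the root persists for nearby `m`,
and this keeps the root on the same side of `z`. -/
lemma continuousAt_xRoot {m : ℝ} (hm : m ∈ Ioo (0 : ℝ) 1) : ContinuousAt xRoot m := by
  have hpos := xRoot_pos hm
  obtain ⟨⟨-, hw⟩, h0, h2, h3⟩ := xRoot_spec hm
  have hI : ∀ᶠ m' in 𝓝 m, m' ∈ Ioo (0 : ℝ) 1 := isOpen_Ioo.mem_nhds hm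
  have hcont : ∀ y, ContinuousAt (fun m' => rootFn y m') m := fun y => by
    unfold rootFn; fun_prop
  have hcw : ∀ y, ContinuousAt (fun m' : ℝ => (1 - m') * y) m := fun y => by fun_prop
  have h1m : 0 < 1 - m := by linarith [hm.2]
  refine tendsto_order.2 ⟨fun y hy => ?_, fun y hy => ?_⟩
  · obtain ⟨z, hz1, hz2⟩ := exists_between (max_lt hy hpos)
    have hz := h2 z ((le_max_right _ _).trans_lt hz1) hz2
    filter_upwards [hI, (hcont z).eventually (gt_mem_nhds hz),
      (hcw z).eventually (gt_mem_nhds (show (1 - m) * z < 3 * Real.pi / 2 by nlinarith))]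
      with m' hm' hz' hw'
    exact ((le_max_left _ _).trans_lt hz1).trans (lt_xRoot_of_neg hm' hw'.le hz')
  · have : xRoot m < min y (3 * Real.pi / 2 / (1 - m)) :=
      lt_min hy (by rw [lt_div_iff₀ h1m]; linarith)
    obtain ⟨z, hz1, hz2⟩ := exists_between this
    have hzb : (1 - m) * z ≤ 3 * Real.pi / 2 := by
      have := hz2.trans_le (min_le_right _ _)
      rw [lt_div_iff₀ h1m] at this; linarith
    filter_upwards [hI, (hcont z).eventually (lt_mem_nhds (h3 z hz1 hzb))] with m' hm' hz'
    exact (xRoot_lt_of_pos hm' (hpos.trans hz1) hz').trans (hz2.trans_le (min_le_left _ _))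

/-! ### Monotonicity and differentiability of the root. -/

/-- The term with the slope `M` is kept apart: it disappears both for `M = 0` and, whatever `M` is,
at a zero where both sines vanish. -/
lemma hasDerivAt_rootFn_line (x M m : ℝ) :
    HasDerivAt (fun m' => rootFn (x + M * (m' - m)) m')
      (x * Real.cos x * Real.cos (m * x) - Real.cos (m * x) * Real.sin x
        + m * x * (Real.sin x * Real.sin (m * x))
        + (m ^ 2 - 1) * (M * (Real.sin x * Real.sin (m * x)))) m := by
  have hl : HasDerivAt (fun m' : ℝ => x + M * (m' - m)) M m := by
    simpa using (((hasDerivAt_id m).sub_const m).const_mul M).const_add x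
  have hm : HasDerivAt (fun m' : ℝ => m' * (x + M * (m' - m))) (x + m * M) m := by
    refine (((hasDerivAt_id m).mul hl).congr_deriv ?_)
    simp
  have h := (hl.cos.mul hm.sin).sub (((hasDerivAt_id m).mul hm.cos).mul hl.sin)
  refine h.congr_deriv ?_
  simp only [sub_self, mul_zero, add_zero, id, Pi.mul_apply]
  ring

lemma rootFn_deriv_right_neg {x m : ℝ} (hm : m ∈ Ioo (0 : ℝ) 1)
    (hx1 : Real.pi / 2 < (1 - m) * x) (hx2 : (1 - m) * x < 3 * Real.pi / 2)
    (h : rootFn x m = 0) :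
    x * Real.cos x * Real.cos (m * x) - Real.cos (m * x) * Real.sin x
        + m * x * (Real.sin x * Real.sin (m * x)) < 0 := by
  have hpi := Real.pi_pos
  have hx : 0 < x := pos_of_mul_pos_right (a := 1 - m) (by linarith) (by linarith [hm.2])
  rcases sin_mul_sin_of_rootFn_eq_zero hm hx1 hx2 h with hs | ⟨hs1, hs2⟩
  · unfold rootFn at h
    have hp : 0 < m * x := mul_pos hm.1 hx
    have hsc : Real.sin (m * x) * Real.cos (m * x) < m * x := by
      have := Real.sin_lt (show 0 < 2 * (m * x) by linarith)
      rw [Real.sin_two_mul] at this; linarith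
    -- The zero equation eliminates `cos x`, after multiplication by `sin (m x) ^ 2`; the sign then
    -- follows from `sin (2 t) < 2 t` at `t = m x`.
    have key : (x * Real.cos x * Real.cos (m * x) - Real.cos (m * x) * Real.sin x
        + m * x * (Real.sin x * Real.sin (m * x))) * Real.sin (m * x) ^ 2 =
        (Real.sin x * Real.sin (m * x)) * (m * x - Real.sin (m * x) * Real.cos (m * x)) := by
      have c2 := Real.sin_sq_add_cos_sq (m * x)
      linear_combination (x * Real.cos (m * x) * Real.sin (m * x)) * h +
        m * x * Real.sin x * Real.sin (m * x) * c2
    have hneg := mul_neg_of_neg_of_pos hs (sub_pos.2 hsc)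
    rw [← key] at hneg
    exact (neg_iff_pos_of_mul_neg hneg).2 (by
      have : Real.sin (m * x) ≠ 0 := by rintro h6; rw [h6] at hs; simp at hs
      positivity)
  · have hcos : Real.cos ((1 - m) * x) < 0 :=
      Real.cos_neg_of_pi_div_two_lt_of_lt hx1 (by linarith)
    rw [show (1 - m) * x = x - m * x by ring, Real.cos_sub, hs1, hs2] at hcos
    rw [hs1, hs2]
    nlinarith

/-- Along the line of slope `M` through `(m, xRoot m)`, `rootFn` is strictly decreasing through zero
at `m`, so the graph of `xRoot` crosses this line upwards. -/
lemma xRoot_line {m M : ℝ} (hm : m ∈ Ioo (0 : ℝ) 1)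
    (hM : M * (Real.sin (xRoot m) * Real.sin (m * xRoot m)) = 0) :
    (∀ᶠ m' in 𝓝[>] m, xRoot m + M * (m' - m) < xRoot m') ∧
      (∀ᶠ m' in 𝓝[<] m, xRoot m' < xRoot m + M * (m' - m)) := by
  have hpos := xRoot_pos hm
  obtain ⟨⟨hw1, hw2⟩, h0, -, -⟩ := xRoot_spec hm
  have hd := hasDerivAt_rootFn_line (xRoot m) M m
  rw [hM, mul_zero, add_zero] at hd
  have hev := hd.neg.eventually_gt_lt (neg_pos.2 (rootFn_deriv_right_neg hm hw1 hw2 h0))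
  simp only [Pi.neg_apply, sub_self, mul_zero, add_zero, h0, neg_zero, neg_pos, neg_neg_iff_pos]
    at hev
  have hI : ∀ᶠ m' in 𝓝 m, m' ∈ Ioo (0 : ℝ) 1 := isOpen_Ioo.mem_nhds hm
  have hc1 : ContinuousAt (fun m' => (1 - m') * (xRoot m + M * (m' - m))) m := by fun_prop
  have hc2 : ContinuousAt (fun m' => xRoot m + M * (m' - m)) m := by fun_prop
  have e1 := hc1.eventually (gt_mem_nhds (show (1 - m) * (xRoot m + M * (m - m)) < 3 * Real.pi / 2 by
    simpa using hw2))
  have e2 := hc2.eventually (lt_mem_nhds (show 0 < xRoot m + M * (m - m) by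
    simpa using hpos))
  constructor
  · filter_upwards [hev.1, hI.filter_mono nhdsWithin_le_nhds, e1.filter_mono nhdsWithin_le_nhds]
      with m' h1 h2 h3
    exact lt_xRoot_of_neg h2 h3.le h1
  · filter_upwards [hev.2, hI.filter_mono nhdsWithin_le_nhds, e2.filter_mono nhdsWithin_le_nhds]
      with m' h1 h2 h3
    exact xRoot_lt_of_pos h2 h3 h1

/-- The case `M = 0` of `xRoot_line` gives growth immediately to the right of every point, and
continuity makes this global. -/
lemma strictMonoOn_xRoot : StrictMonoOn xRoot (Ioo 0 1) := by
  have hr : ∀ m ∈ Ioo (0 : ℝ) 1, ∀ᶠ m' in 𝓝[>] m, xRoot m < xRoot m' := by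
    intro m hm
    simpa using (xRoot_line (M := 0) hm (by simp)).1
  have mono : ∀ a ∈ Ioo (0 : ℝ) 1, ∀ b ∈ Ioo (0 : ℝ) 1, a ≤ b → xRoot a ≤ xRoot b := by
    intro a ha b hb hab
    have hsub : Icc a b ⊆ {y | xRoot a ≤ xRoot y} := by
      have hco : ContinuousOn xRoot (Icc a b) := fun y hy =>
        (continuousAt_xRoot ⟨ha.1.trans_le hy.1, hy.2.trans_lt hb.2⟩).continuousWithinAt
      apply IsClosed.Icc_subset_of_forall_exists_gt
      · rw [inter_comm]
        exact hco.preimage_isClosed_of_isClosed isClosed_Icc isClosed_Ici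
      · exact le_refl (xRoot a)
      · rintro y ⟨hy0, hya, hyb⟩ z hz
        obtain ⟨w, hw1, hw2⟩ := ((hr y ⟨ha.1.trans_le hya, hyb.trans hb.2⟩).and
          (Ioo_mem_nhdsGT (show y < z from hz))).exists
        exact ⟨w, le_trans hy0 hw1.le, hw2.1, hw2.2.le⟩
    exact hsub ⟨hab, le_rfl⟩
  intro a ha b hb hab
  obtain ⟨w, hw1, hw2⟩ := ((hr a ha).and (Ioo_mem_nhdsGT hab)).exists
  exact hw1.trans_le (mono w ⟨ha.1.trans hw2.1, hw2.2.trans hb.2⟩ b hb hw2.2.le)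

/-- At a degenerate zero every slope `M` is admissible in `xRoot_line`, so the difference quotients
eventually exceed each `M`. -/
lemma tendsto_slope_xRoot {m : ℝ} (hm : m ∈ Ioo (0 : ℝ) 1)
    (h : Real.sin (xRoot m) * Real.sin (m * xRoot m) = 0) :
    Tendsto (slope xRoot m) (𝓝[≠] m) atTop := by
  rw [tendsto_atTop]
  intro M
  obtain ⟨h1, h2⟩ := xRoot_line (M := M) hm (by rw [h, mul_zero])
  rw [← nhdsLT_sup_nhdsGT, eventually_sup]
  constructor
  · filter_upwards [h2, self_mem_nhdsWithin] with y hy hym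
    have : y - m < 0 := sub_neg.2 hym
    rw [slope_def_field, le_div_iff_of_neg this]
    linarith
  · filter_upwards [h1, self_mem_nhdsWithin] with y hy hym
    have : 0 < y - m := sub_pos.2 hym
    rw [slope_def_field, le_div_iff₀ this]
    linarith

lemma contDiffAt_xRoot {m : ℝ} (hm : m ∈ Ioo (0 : ℝ) 1)
    (h : Real.sin (xRoot m) * Real.sin (m * xRoot m) ≠ 0) : ContDiffAt ℝ 1 xRoot m := by
  obtain ⟨-, h0, -, -⟩ := xRoot_spec hm
  set f : ℝ × ℝ → ℝ := fun q => rootFn q.2 q.1 with hf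
  have cdf : ContDiffAt ℝ 1 f (m, xRoot m) := by
    rw [hf]; unfold rootFn
    fun_prop
  have hfd : HasFDerivAt f (fderiv ℝ f (m, xRoot m)) (m, xRoot m) :=
    (cdf.differentiableAt one_ne_zero).hasFDerivAt
  have hderiv : fderiv ℝ f (m, xRoot m) (0, 1) =
      (m ^ 2 - 1) * (Real.sin (xRoot m) * Real.sin (m * xRoot m)) := by
    have hline : HasDerivAt (fun y : ℝ => (m, y)) ((0 : ℝ), (1 : ℝ)) (xRoot m) :=
      (hasDerivAt_const _ _).prodMk (hasDerivAt_id _)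
    have h1 := hfd.comp_hasDerivAt (xRoot m) hline
    exact h1.unique (hasDerivAt_rootFn_left (xRoot m) m)
  have hc : (m ^ 2 - 1) * (Real.sin (xRoot m) * Real.sin (m * xRoot m)) ≠ 0 :=
    mul_ne_zero (by nlinarith [hm.1, hm.2]) h
  have if₂ : (fderiv ℝ f (m, xRoot m) ∘L .inr ℝ ℝ ℝ).IsInvertible := by
    refine ⟨ContinuousLinearEquiv.unitsEquivAut ℝ (Units.mk0 _ hc), ?_⟩
    ext
    simp [hderiv]
  have hev := cdf.eventually_apply_eq_iff_implicitFunction one_ne_zero if₂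
  -- Continuity of `xRoot` is what identifies it with the local implicit function.
  have hcp : Tendsto (fun m' => (m', xRoot m')) (𝓝 m) (𝓝 (m, xRoot m)) :=
    (continuousAt_id.prodMk (continuousAt_xRoot hm))
  refine (cdf.contDiffAt_implicitFunction one_ne_zero if₂).congr_of_eventuallyEq ?_
  filter_upwards [hcp.eventually hev, isOpen_Ioo.mem_nhds hm] with m' h1 h2
  refine (h1.1 ?_).symm
  simp only [hf, h0, (xRoot_spec h2).2.1]

/-- Here `x = n π` and `m x = j π`. The window leaves only `n - j = 1`, so `m = j / (j + 1)`. -/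
lemma eq_div_of_sin_mul_sin_eq_zero {m : ℝ} (hm : m ∈ Ioo (0 : ℝ) 1)
    (h : Real.sin (xRoot m) * Real.sin (m * xRoot m) = 0) :
    ∃ k : ℕ, 1 ≤ k ∧ m = (k : ℝ) / (k + 1) := by
  have hx := xRoot_pos hm
  obtain ⟨⟨hw1, hw2⟩, h0, -, -⟩ := xRoot_spec hm
  have hpi := Real.pi_pos
  rcases sin_mul_sin_of_rootFn_eq_zero hm hw1 hw2 h0 with hs | ⟨hs1, hs2⟩
  · exact absurd h hs.ne
  obtain ⟨n, hn⟩ := Real.sin_eq_zero_iff.1 hs1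
  obtain ⟨j, hj⟩ := Real.sin_eq_zero_iff.1 hs2
  have hnj : ((n - j : ℤ) : ℝ) * Real.pi = (1 - m) * xRoot m := by
    push_cast; linarith
  have h1 : n - j = 1 := by
    have a1 : (0:ℝ) < ((n - j : ℤ) : ℝ) := by
      refine pos_of_mul_pos_left (b := Real.pi) ?_ hpi.le
      linarith
    have a2 : ((n - j : ℤ) : ℝ) < 2 := by
      refine lt_of_mul_lt_mul_right (a := Real.pi) ?_ hpi.le
      linarith
    have a3 : 0 < n - j := by exact_mod_cast a1
    have a4 : n - j < 2 := by exact_mod_cast a2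
    omega
  have hjpos : 0 < j := by
    have : (0:ℝ) < (j : ℝ) := by
      refine pos_of_mul_pos_left (b := Real.pi) ?_ hpi.le
      rw [hj]; exact mul_pos hm.1 hx
    exact_mod_cast this
  refine ⟨j.toNat, by omega, ?_⟩
  have hcast : ((j.toNat : ℕ) : ℝ) = (j : ℝ) := by
    have : ((j.toNat : ℕ) : ℤ) = j := Int.toNat_of_nonneg hjpos.le
    exact_mod_cast this
  have hn' : (n : ℝ) = j + 1 := by
    have : n = j + 1 := by omega
    exact_mod_cast this
  have hj0 : (0:ℝ) < j := by exact_mod_cast hjpos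
  rw [hcast, eq_div_iff (by linarith), ← hn']
  have : m * (n * Real.pi) = j * Real.pi := by rw [hn, hj]
  refine mul_right_cancel₀ hpi.ne' ?_
  linarith

/-! ### Comparison of the root with `π / (1 - m)`. -/

lemma two_mul_rootFn_pi_div {m : ℝ} (hm : m ∈ Ioo (0 : ℝ) 1) :
    2 * rootFn (Real.pi / (1 - m)) m =
      (1 - m) * Real.sin ((1 + m) / (1 - m) * Real.pi) := by
  have h1m : 1 - m ≠ 0 := by linarith [hm.2]
  rw [two_mul_rootFn, mul_div_cancel₀ _ h1m, Real.sin_pi, div_mul_eq_mul_div, mul_div_assoc]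
  ring

lemma xRoot_eq_pi_div {m : ℝ} (hm : m ∈ Ioo (0 : ℝ) 1)
    (h : Real.sin ((1 + m) / (1 - m) * Real.pi) = 0) : xRoot m = Real.pi / (1 - m) := by
  have h1m : 0 < 1 - m := by linarith [hm.2]
  have hpi := Real.pi_pos
  have e := two_mul_rootFn_pi_div hm
  rw [h] at e
  exact xRoot_eq_of_eq_zero hm (by positivity)
    (by rw [mul_div_cancel₀ _ h1m.ne']; linarith) (by linarith)

lemma xRoot_lt_pi_div {m : ℝ} (hm : m ∈ Ioo (0 : ℝ) 1)
    (h : 0 < Real.sin ((1 + m) / (1 - m) * Real.pi)) : xRoot m < Real.pi / (1 - m) := by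
  have h1m : 0 < 1 - m := by linarith [hm.2]
  have hpi := Real.pi_pos
  have e := two_mul_rootFn_pi_div hm
  have := mul_pos h1m h
  exact xRoot_lt_of_pos hm (by positivity) (by linarith)

lemma pi_div_lt_xRoot {m : ℝ} (hm : m ∈ Ioo (0 : ℝ) 1)
    (h : Real.sin ((1 + m) / (1 - m) * Real.pi) < 0) : Real.pi / (1 - m) < xRoot m := by
  have h1m : 0 < 1 - m := by linarith [hm.2]
  have hpi := Real.pi_pos
  have e := two_mul_rootFn_pi_div hm
  have := mul_neg_of_pos_of_neg h1m h
  exact lt_xRoot_of_neg hm (by rw [mul_div_cancel₀ _ h1m.ne']; linarith) (by linarith)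

/-! ### From `xRoot` to `p₁`, and the parameter intervals. -/

lemma rootFn_eq_zero_iff_mem {m : ℝ} (hm : 0 < m) (x : ℝ) :
    m * x ∈ posRoots m ↔ 0 < x ∧ rootFn x m = 0 := by
  simp only [posRoots, mem_ofPred_eq, g₁_mul_self hm.ne', mul_pos_iff_of_pos_left hm]

lemma isLeast_of_lt_one {m : ℝ} (hm : m ∈ Ioo (0 : ℝ) 1) :
    IsLeast (posRoots m) (m * xRoot m) := by
  refine ⟨(rootFn_eq_zero_iff_mem hm.1 _).2 ⟨xRoot_pos hm, (xRoot_spec hm).2.1⟩, fun p hp => ?_⟩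
  rw [← mul_div_cancel₀ p hm.1.ne'] at hp ⊢
  obtain ⟨h1, h2⟩ := (rootFn_eq_zero_iff_mem hm.1 _).1 hp
  have := xRoot_le_of_eq_zero hm h1 h2
  have h0 := hm.1
  gcongr

lemma p₁_of_lt_one {m : ℝ} (hm : m ∈ Ioo (0 : ℝ) 1) : p₁ m = m * xRoot m :=
  (isLeast_of_lt_one hm).csInf_eq

lemma g₁_inv (p : ℝ) {m : ℝ} (hm : m ≠ 0) : g₁ p m = -m * rootFn p (1 / m) := by
  unfold g₁ rootFn
  rw [show 1 / m * p = p / m by field_simp]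
  field_simp
  ring

lemma one_div_mem_Ioo {m : ℝ} (hm : 1 < m) : 1 / m ∈ Ioo (0 : ℝ) 1 :=
  ⟨by positivity, by rw [div_lt_one (by linarith)]; exact hm⟩

lemma isLeast_of_one_lt {m : ℝ} (hm : 1 < m) : IsLeast (posRoots m) (xRoot (1 / m)) := by
  have hI := one_div_mem_Ioo hm
  have hm0 : m ≠ 0 := by linarith
  have h0 := (xRoot_spec hI).2.1
  refine ⟨⟨xRoot_pos hI, by rw [g₁_inv _ hm0, h0, mul_zero]⟩, fun p hp => ?_⟩
  obtain ⟨h1, h2⟩ := hp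
  rw [g₁_inv _ hm0] at h2
  exact xRoot_le_of_eq_zero hI h1 ((mul_eq_zero.1 h2).resolve_left (neg_ne_zero.2 hm0))

lemma p₁_of_one_lt {m : ℝ} (hm : 1 < m) : p₁ m = xRoot (1 / m) :=
  (isLeast_of_one_lt hm).csInf_eq

/-- The map `m ↦ (1 + m) / (1 - m)` is increasing with inverse `c ↦ (c - 1) / (c + 1)`; it sends the
interval endpoints of the theorem to consecutive integers. -/
lemma lt_ratio_iff {m c : ℝ} (hm : m ∈ Ioo (0 : ℝ) 1) (hc : 0 < c + 1) :
    c < (1 + m) / (1 - m) ↔ (c - 1) / (c + 1) < m := by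
  have h1m : 0 < 1 - m := by linarith [hm.2]
  rw [lt_div_iff₀ h1m, div_lt_iff₀ hc]
  constructor <;> intro h <;> linarith

lemma ratio_lt_iff {m c : ℝ} (hm : m ∈ Ioo (0 : ℝ) 1) (hc : 0 < c + 1) :
    (1 + m) / (1 - m) < c ↔ m < (c - 1) / (c + 1) := by
  have h1m : 0 < 1 - m := by linarith [hm.2]
  rw [div_lt_iff₀ h1m, lt_div_iff₀ hc]
  constructor <;> intro h <;> linarith

lemma mem_lower_interval {k : ℕ} (hk : 1 ≤ k) {m : ℝ}
    (hm : m ∈ Ioo ((2 * (k : ℝ) - 1) / (2 * k + 1)) ((k : ℝ) / (k + 1))) :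
    m ∈ Ioo (0 : ℝ) 1 ∧ 2 * (k : ℝ) < (1 + m) / (1 - m) ∧ (1 + m) / (1 - m) < 2 * k + 1 := by
  have hk' : (1 : ℝ) ≤ k := by exact_mod_cast hk
  have hI : m ∈ Ioo (0 : ℝ) 1 := by
    refine ⟨lt_trans (by apply div_pos <;> linarith) hm.1, hm.2.trans ?_⟩
    rw [div_lt_one (by linarith)]; linarith
  refine ⟨hI, (lt_ratio_iff hI (by linarith)).2 hm.1, (ratio_lt_iff hI (by linarith)).2 ?_⟩
  refine hm.2.trans_eq ?_
  rw [div_eq_div_iff (by positivity) (by positivity)]; ring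

lemma mem_upper_interval {k : ℕ} {m : ℝ}
    (hm : m ∈ Ioo ((k : ℝ) / (k + 1)) ((2 * (k : ℝ) + 1) / (2 * k + 3))) :
    m ∈ Ioo (0 : ℝ) 1 ∧ 2 * (k : ℝ) + 1 < (1 + m) / (1 - m) ∧
      (1 + m) / (1 - m) < 2 * k + 2 := by
  have hk' : (0 : ℝ) ≤ k := Nat.cast_nonneg k
  have hI : m ∈ Ioo (0 : ℝ) 1 := by
    refine ⟨lt_of_le_of_lt (by positivity) hm.1, hm.2.trans ?_⟩
    rw [div_lt_one (by linarith)]; linarith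
  refine ⟨hI, (lt_ratio_iff hI (by linarith)).2 ?_, (ratio_lt_iff hI (by linarith)).2 ?_⟩
  · refine lt_of_eq_of_lt ?_ hm.1
    rw [div_eq_div_iff (by positivity) (by positivity)]; ring
  · refine hm.2.trans_eq ?_
    rw [div_eq_div_iff (by positivity) (by positivity)]; ring

lemma xRoot_lt_pi_div_of_lower {k : ℕ} (hk : 1 ≤ k) {m : ℝ}
    (hm : m ∈ Ioo ((2 * (k : ℝ) - 1) / (2 * k + 1)) ((k : ℝ) / (k + 1))) :
    xRoot m < Real.pi / (1 - m) := by
  obtain ⟨hI, h1, h2⟩ := mem_lower_interval hk hm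
  refine xRoot_lt_pi_div hI ?_
  have hpi := Real.pi_pos
  rw [← Real.sin_sub_nat_mul_two_pi _ k]
  apply Real.sin_pos_of_pos_of_lt_pi <;> nlinarith

/-- The case `k = 0` is allowed, since it covers `0 < m < 1 / 3` in part (e). -/
lemma pi_div_lt_xRoot_of_upper {k : ℕ} {m : ℝ}
    (hI : m ∈ Ioo (0 : ℝ) 1) (h1 : 2 * (k : ℝ) + 1 < (1 + m) / (1 - m))
    (h2 : (1 + m) / (1 - m) < 2 * k + 2) :
    Real.pi / (1 - m) < xRoot m := by
  refine pi_div_lt_xRoot hI ?_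
  have hpi := Real.pi_pos
  rw [← Real.sin_sub_nat_mul_two_pi _ (k + 1)]
  push_cast
  apply Real.sin_neg_of_neg_of_neg_pi_lt <;> nlinarith

lemma div_add_mem_Ioo {k : ℕ} (hk : 1 ≤ k) {c : ℝ} (hc : 0 < c) :
    (k : ℝ) / (k + c) ∈ Ioo (0 : ℝ) 1 := by
  have hk' : (1 : ℝ) ≤ k := by exact_mod_cast hk
  refine ⟨by positivity, ?_⟩
  rw [div_lt_one (by positivity)]; linarith

lemma xRoot_div_add_two {k : ℕ} (hk : 1 ≤ k) :
    xRoot ((k : ℝ) / (k + 2)) = Real.pi / (1 - (k : ℝ) / (k + 2)) := by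
  refine xRoot_eq_pi_div (div_add_mem_Ioo hk two_pos) ?_
  have : (1 + (k : ℝ) / (k + 2)) / (1 - (k : ℝ) / (k + 2)) = ((k + 1 : ℕ) : ℝ) := by
    have h1 : (k : ℝ) + 2 ≠ 0 := by positivity
    rw [one_add_div h1, one_sub_div h1, div_div_div_cancel_right₀ h1]
    push_cast
    rw [add_sub_cancel_left]; ring
  rw [this, Real.sin_nat_mul_pi]

lemma sin_mul_sin_xRoot_div_add_one {k : ℕ} (hk : 1 ≤ k) :
    Real.sin (xRoot ((k : ℝ) / (k + 1))) *
      Real.sin ((k : ℝ) / (k + 1) * xRoot ((k : ℝ) / (k + 1))) = 0 := by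
  have hpi := Real.pi_pos
  have h1 : (k : ℝ) + 1 ≠ 0 := by positivity
  have hs : Real.sin (((k : ℝ) + 1) * Real.pi) = 0 := by
    have := Real.sin_nat_mul_pi (k + 1)
    push_cast at this; exact this
  have hx : xRoot ((k : ℝ) / (k + 1)) = ((k : ℝ) + 1) * Real.pi := by
    refine xRoot_eq_of_eq_zero (div_add_mem_Ioo hk one_pos) (by positivity) ?_ ?_
    · rw [one_sub_div h1, div_mul_eq_mul_div, mul_comm _ (((k : ℝ) + 1) * Real.pi), mul_assoc,
        mul_div_cancel_left₀ _ h1]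
      linarith
    · unfold rootFn
      rw [← mul_assoc, div_mul_cancel₀ _ h1, Real.sin_nat_mul_pi, hs]; ring
  rw [hx, hs, zero_mul]

/-! ### Regularity, monotonicity and sign change for `p₁`. -/

lemma continuousOn_p₁_lt_one : ContinuousOn p₁ (Ioo 0 1) := by
  refine ContinuousOn.congr (f := fun m => m * xRoot m) (fun m hm => ?_)
    fun m hm => p₁_of_lt_one hm
  exact (continuousAt_id.mul (continuousAt_xRoot hm)).continuousWithinAt

lemma strictMonoOn_p₁ : StrictMonoOn p₁ (Ioo 0 1) := by
  intro a ha b hb hab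
  rw [p₁_of_lt_one ha, p₁_of_lt_one hb]
  exact mul_lt_mul'' hab (strictMonoOn_xRoot ha hb hab) ha.1.le (xRoot_pos ha).le

lemma continuousOn_p₁_one_lt : ContinuousOn p₁ (Ioi 1) := by
  refine ContinuousOn.congr (f := fun m => xRoot (1 / m)) (fun m hm => ?_)
    fun m hm => p₁_of_one_lt hm
  have hm0 : m ≠ 0 := by linarith [show 1 < m from hm]
  have h1 : ContinuousAt (fun m : ℝ => 1 / m) m := by fun_prop (disch := assumption)
  exact (ContinuousAt.comp (g := xRoot) (continuousAt_xRoot (one_div_mem_Ioo hm))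
    h1).continuousWithinAt

lemma strictAntiOn_p₁ : StrictAntiOn p₁ (Ioi 1) := by
  intro a ha b hb hab
  rw [p₁_of_one_lt ha, p₁_of_one_lt hb]
  have ha' : (1 : ℝ) < a := ha
  exact strictMonoOn_xRoot (one_div_mem_Ioo hb) (one_div_mem_Ioo ha)
    (one_div_lt_one_div_of_lt (by linarith) hab)

lemma eventually_p₁_lt_one {m : ℝ} (hm : m ∈ Ioo (0 : ℝ) 1) :
    p₁ =ᶠ[𝓝 m] fun m => m * xRoot m := by
  filter_upwards [isOpen_Ioo.mem_nhds hm] with m' hm' using p₁_of_lt_one hm'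

lemma eventually_p₁_one_lt {m : ℝ} (hm : 1 < m) :
    p₁ =ᶠ[𝓝 m] fun m => xRoot (1 / m) := by
  filter_upwards [isOpen_Ioi.mem_nhds hm] with m' hm' using p₁_of_one_lt hm'

lemma contDiffAt_p₁_lt_one {m : ℝ} (hm : m ∈ Ioo (0 : ℝ) 1)
    (h : ∀ k : ℕ, 1 ≤ k → m ≠ (k : ℝ) / (k + 1)) : ContDiffAt ℝ 1 p₁ m := by
  refine ContDiffAt.congr_of_eventuallyEq ?_ (eventually_p₁_lt_one hm)
  refine contDiffAt_id.mul (contDiffAt_xRoot hm fun h0 => ?_)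
  obtain ⟨k, hk, hmk⟩ := eq_div_of_sin_mul_sin_eq_zero hm h0
  exact h k hk hmk

lemma contDiffAt_p₁_one_lt {m : ℝ} (hm : 1 < m)
    (h : ∀ k : ℕ, 1 ≤ k → m ≠ ((k : ℝ) + 1) / k) : ContDiffAt ℝ 1 p₁ m := by
  refine ContDiffAt.congr_of_eventuallyEq ?_ (eventually_p₁_one_lt hm)
  have hI := one_div_mem_Ioo hm
  have hm0 : m ≠ 0 := by linarith
  have h1 : ContDiffAt ℝ 1 (fun m : ℝ => 1 / m) m := contDiffAt_const.div contDiffAt_id hm0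
  refine ContDiffAt.comp (g := xRoot) m (contDiffAt_xRoot hI fun h0 => ?_) h1
  obtain ⟨k, hk, hmk⟩ := eq_div_of_sin_mul_sin_eq_zero hI h0
  refine h k hk ?_
  rw [← one_div_one_div m, hmk, one_div_div]

lemma tendsto_slope_p₁_lt_one {k : ℕ} (hk : 1 ≤ k) :
    Tendsto (slope p₁ ((k : ℝ) / (k + 1))) (𝓝[≠] ((k : ℝ) / (k + 1))) atTop := by
  have hI : (k : ℝ) / (k + 1) ∈ Ioo (0 : ℝ) 1 := div_add_mem_Ioo hk one_pos
  have ht := tendsto_slope_xRoot hI (sin_mul_sin_xRoot_div_add_one hk)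
  generalize (k : ℝ) / (k + 1) = m at hI ht
  have h1 : Tendsto (fun y : ℝ => y) (𝓝[≠] m) (𝓝 m) := tendsto_id.mono_left nhdsWithin_le_nhds
  -- Product rule for difference quotients: the slope of `y * xRoot y` is `y` times the slope of
  -- `xRoot`, plus `xRoot m`.
  refine Tendsto.congr' ?_ (tendsto_atTop_add_const_right _ (xRoot m) (h1.pos_mul_atTop hI.1 ht))
  filter_upwards [self_mem_nhdsWithin, (isOpen_Ioo.mem_nhds hI |> nhdsWithin_le_nhds)]
    with y hy hyI
  have : y - m ≠ 0 := sub_ne_zero.2 hy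
  rw [slope_def_field, slope_def_field, p₁_of_lt_one hI, p₁_of_lt_one hyI]
  field_simp
  ring

lemma tendsto_slope_p₁_one_lt {k : ℕ} (hk : 1 ≤ k) :
    Tendsto (slope p₁ (((k : ℝ) + 1) / k)) (𝓝[≠] (((k : ℝ) + 1) / k)) atBot := by
  have hI : (k : ℝ) / (k + 1) ∈ Ioo (0 : ℝ) 1 := div_add_mem_Ioo hk one_pos
  have ht := tendsto_slope_xRoot hI (sin_mul_sin_xRoot_div_add_one hk)
  have hm : 1 < ((k : ℝ) + 1) / k := by
    rw [← one_div_div, one_lt_div hI.1]; exact hI.2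
  rw [← one_div_div ((k : ℝ) + 1) k] at ht
  generalize ((k : ℝ) + 1) / k = m at hm ht
  have hm0 : m ≠ 0 := by linarith
  have h1 : Tendsto (fun y : ℝ => 1 / y) (𝓝[≠] m) (𝓝[≠] (1 / m)) := by
    refine tendsto_nhdsWithin_iff.2 ⟨?_, ?_⟩
    · exact (ContinuousAt.tendsto (by fun_prop (disch := assumption))).mono_left
        nhdsWithin_le_nhds
    · filter_upwards [self_mem_nhdsWithin] with y hy h
      refine hy ?_
      rw [← one_div_one_div y, show 1 / y = 1 / m from h, one_div_one_div]
      rfl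
  -- This is the difference quotient of `1 / y`; its negative limit turns `+∞` into `-∞`.
  have h2 : Tendsto (fun y : ℝ => -(1 / (m * y))) (𝓝[≠] m) (𝓝 (-(1 / (m * m)))) :=
    (ContinuousAt.tendsto (by fun_prop (disch := positivity))).mono_left nhdsWithin_le_nhds
  have hneg : -(1 / (m * m)) < 0 := by
    have : 0 < m := by linarith
    rw [neg_lt_zero]; positivity
  refine Tendsto.congr' ?_ ((ht.comp h1).atTop_mul_neg hneg h2)
  filter_upwards [self_mem_nhdsWithin, (isOpen_Ioi.mem_nhds hm |> nhdsWithin_le_nhds)]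
    with y hy hyI
  have hyI' : 1 < y := hyI
  have hy0 : y ≠ 0 := by linarith
  have h3 : y - m ≠ 0 := sub_ne_zero.2 hy
  have h4 : m - y ≠ 0 := sub_ne_zero.2 (Ne.symm hy)
  rw [Function.comp_apply, slope_def_field, slope_def_field, p₁_of_one_lt hm, p₁_of_one_lt hyI,
    show 1 / y - 1 / m = (m - y) / (m * y) by field_simp]
  field_simp
  ring

lemma changesSignAt_xRoot {m : ℝ} (hm : m ∈ Ioo (0 : ℝ) 1) :
    ∃ ε, 0 < ε ∧ (∀ u ∈ Ioo (xRoot m - ε) (xRoot m), rootFn u m < 0) ∧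
      ∀ v ∈ Ioo (xRoot m) (xRoot m + ε), 0 < rootFn v m := by
  obtain ⟨⟨-, hw⟩, -, h1, h2⟩ := xRoot_spec hm
  have h1m : 0 < 1 - m := by linarith [hm.2]
  refine ⟨min (xRoot m) (3 * Real.pi / 2 / (1 - m) - xRoot m),
    lt_min (xRoot_pos hm) (by rw [sub_pos, lt_div_iff₀ h1m]; linarith), fun u hu => ?_,
    fun v hv => ?_⟩
  · exact h1 u (by linarith [hu.1, min_le_left (xRoot m) (3 * Real.pi / 2 / (1 - m) - xRoot m)])
      hu.2
  · refine h2 v hv.1 ?_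
    have h3 : v < 3 * Real.pi / 2 / (1 - m) := by
      linarith [hv.2, min_le_right (xRoot m) (3 * Real.pi / 2 / (1 - m) - xRoot m)]
    rw [lt_div_iff₀ h1m] at h3; linarith

lemma changesSignAt_g₁ {m : ℝ} (hm : m ∈ Ioo 0 1 ∪ Ioi 1) :
    ChangesSignAt (fun p => g₁ p m) (p₁ m) := by
  rcases hm with hm | hm
  · obtain ⟨ε, hε, h1, h2⟩ := changesSignAt_xRoot hm
    have hm0 := hm.1
    rw [p₁_of_lt_one hm]
    refine ⟨m * ε, by positivity, Or.inl ⟨fun u hu => ?_, fun v hv => ?_⟩⟩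
    · have e : u = m * (u / m) := (mul_div_cancel₀ u hm0.ne').symm
      rw [e] at hu ⊢
      rw [← mul_sub] at hu
      simp only [g₁_mul_self hm0.ne']
      exact h1 _ ⟨lt_of_mul_lt_mul_left hu.1 hm0.le, lt_of_mul_lt_mul_left hu.2 hm0.le⟩
    · have e : v = m * (v / m) := (mul_div_cancel₀ v hm0.ne').symm
      rw [e] at hv ⊢
      rw [← mul_add] at hv
      simp only [g₁_mul_self hm0.ne']
      exact h2 _ ⟨lt_of_mul_lt_mul_left hv.1 hm0.le, lt_of_mul_lt_mul_left hv.2 hm0.le⟩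
  · have hm1 : 1 < m := hm
    obtain ⟨ε, hε, h1, h2⟩ := changesSignAt_xRoot (one_div_mem_Ioo hm1)
    rw [p₁_of_one_lt hm]
    refine ⟨ε, hε, Or.inr ⟨fun u hu => ?_, fun v hv => ?_⟩⟩
    · simp only [g₁_inv u (show m ≠ 0 by linarith)]
      exact mul_pos_of_neg_of_neg (by linarith) (h1 u hu)
    · simp only [g₁_inv v (show m ≠ 0 by linarith)]
      exact mul_neg_of_neg_of_pos (by linarith) (h2 v hv)

lemma exists_isLeast_and_reflection {m : ℝ} (hm : m ∈ Ioo 0 1 ∪ Ioi 1) :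
    IsLeast (posRoots m) (p₁ m) ∧ p₁ m = m * p₁ (1 / m) := by
  rcases hm with hm | hm
  · refine ⟨by rw [p₁_of_lt_one hm]; exact isLeast_of_lt_one hm, ?_⟩
    rw [p₁_of_lt_one hm, p₁_of_one_lt (by rw [lt_div_iff₀ hm.1]; linarith [hm.2]),
      one_div_one_div]
  · have hm1 : 1 < m := hm
    refine ⟨by rw [p₁_of_one_lt hm]; exact isLeast_of_one_lt hm, ?_⟩
    rw [p₁_of_one_lt hm, p₁_of_lt_one (one_div_mem_Ioo hm), ← mul_assoc,
      mul_one_div_cancel (by linarith), one_mul]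

/-! ### Taylor bounds, the equation `tan x = x`, and part (e). -/

lemma le_of_hasDerivAt_nonneg {f f' : ℝ → ℝ} (h : ∀ x, HasDerivAt f (f' x) x)
    (hf' : ∀ x, 0 < x → 0 ≤ f' x) {x : ℝ} (hx : 0 ≤ x) : f 0 ≤ f x := by
  have : MonotoneOn f (Ici 0) := by
    refine monotoneOn_of_deriv_nonneg (convex_Ici 0)
      (fun y _ => (h y).continuousAt.continuousWithinAt)
      (fun y _ => (h y).differentiableAt.differentiableWithinAt) fun y hy => ?_
    rw [interior_Ici] at hy
    rw [(h y).deriv]; exact hf' y hy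
  exact this self_mem_Ici hx hx

lemma hasDerivAt_pow_div (n : ℕ) (c x : ℝ) :
    HasDerivAt (fun y : ℝ => y ^ n / c) (n * x ^ (n - 1) / c) x :=
  (hasDerivAt_pow n x).div_const c

lemma sin_ge_cubic {x : ℝ} (hx : 0 ≤ x) : x - x ^ 3 / 6 ≤ Real.sin x := by
  rcases hx.eq_or_lt with rfl | h
  · simp
  · exact (Real.sin_gt_sub_cube h).le

/-- This bound and the next three each follow from the preceding one by integration from `0`. The
higher degrees serve to certify the decimals of `ρ`. -/
lemma cos_le_quartic {x : ℝ} (hx : 0 ≤ x) : Real.cos x ≤ 1 - x ^ 2 / 2 + x ^ 4 / 24 := by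
  have h := le_of_hasDerivAt_nonneg
    (f := fun x => 1 - x ^ 2 / 2 + x ^ 4 / 24 - Real.cos x)
    (fun x => (((hasDerivAt_pow_div 2 2 x).const_sub 1).add (hasDerivAt_pow_div 4 24 x)).sub
      (Real.hasDerivAt_cos x)) (fun x hx => ?_) hx
  · simp at h; linarith
  · have := sin_ge_cubic hx.le
    norm_num; linarith

lemma sin_le_quintic {x : ℝ} (hx : 0 ≤ x) : Real.sin x ≤ x - x ^ 3 / 6 + x ^ 5 / 120 := by
  have h := le_of_hasDerivAt_nonneg
    (f := fun x => x - x ^ 3 / 6 + x ^ 5 / 120 - Real.sin x)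
    (fun x => (((hasDerivAt_id x).sub (hasDerivAt_pow_div 3 6 x)).add
      (hasDerivAt_pow_div 5 120 x)).sub (Real.hasDerivAt_sin x)) (fun x hx => ?_) hx
  · simp at h; linarith
  · have := cos_le_quartic hx.le
    norm_num; linarith

lemma cos_ge_sextic {x : ℝ} (hx : 0 ≤ x) :
    1 - x ^ 2 / 2 + x ^ 4 / 24 - x ^ 6 / 720 ≤ Real.cos x := by
  have h := le_of_hasDerivAt_nonneg
    (f := fun x => Real.cos x - (1 - x ^ 2 / 2 + x ^ 4 / 24 - x ^ 6 / 720))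
    (fun x => (Real.hasDerivAt_cos x).sub
      ((((hasDerivAt_pow_div 2 2 x).const_sub 1).add (hasDerivAt_pow_div 4 24 x)).sub
        (hasDerivAt_pow_div 6 720 x))) (fun x hx => ?_) hx
  · simp at h; linarith
  · have := sin_le_quintic hx.le
    norm_num; linarith

lemma sin_ge_septic {x : ℝ} (hx : 0 ≤ x) :
    x - x ^ 3 / 6 + x ^ 5 / 120 - x ^ 7 / 5040 ≤ Real.sin x := by
  have h := le_of_hasDerivAt_nonneg
    (f := fun x => Real.sin x - (x - x ^ 3 / 6 + x ^ 5 / 120 - x ^ 7 / 5040))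
    (fun x => (Real.hasDerivAt_sin x).sub
      ((((hasDerivAt_id x).sub (hasDerivAt_pow_div 3 6 x)).add (hasDerivAt_pow_div 5 120 x)).sub
        (hasDerivAt_pow_div 7 5040 x))) (fun x hx => ?_) hx
  · simp at h; linarith
  · have := cos_ge_sextic hx.le
    norm_num; linarith

lemma strictAntiOn_sin_sub_mul_cos :
    StrictAntiOn (fun x => Real.sin x - x * Real.cos x) (Icc Real.pi (3 * Real.pi / 2)) := by
  have hd : ∀ x, HasDerivAt (fun x => Real.sin x - x * Real.cos x) (x * Real.sin x) x := by
    intro x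
    refine ((Real.hasDerivAt_sin x).sub
      ((hasDerivAt_id x).mul (Real.hasDerivAt_cos x))).congr_deriv ?_
    simp
  refine strictAntiOn_of_deriv_neg (convex_Icc _ _)
    (fun y _ => (hd y).continuousAt.continuousWithinAt) fun y hy => ?_
  rw [interior_Icc] at hy
  rw [(hd y).deriv]
  have hpi := Real.pi_pos
  refine mul_neg_of_pos_of_neg (by linarith [hy.1]) ?_
  rw [← Real.sin_sub_two_pi]
  apply Real.sin_neg_of_neg_of_neg_pi_lt <;> linarith [hy.1, hy.2]

lemma tan_eq_self_iff {x : ℝ} (hx : x ∈ Ioo Real.pi (3 * Real.pi / 2)) :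
    Real.tan x = x ↔ Real.sin x - x * Real.cos x = 0 := by
  have hpi := Real.pi_pos
  have hc : Real.cos x < 0 :=
    Real.cos_neg_of_pi_div_two_lt_of_lt (by linarith [hx.1]) (by linarith [hx.2])
  rw [Real.tan_eq_sin_div_cos, div_eq_iff hc.ne, sub_eq_zero]

/-- Near `ρ` the reflected variable `z` is about `0.219`, small enough for short Taylor polynomials
to be accurate. -/
lemma sin_sub_mul_cos_reflect (z : ℝ) :
    Real.sin (3 * Real.pi / 2 - z) - (3 * Real.pi / 2 - z) * Real.cos (3 * Real.pi / 2 - z) =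
      (3 * Real.pi / 2 - z) * Real.sin z - Real.cos z := by
  rw [show 3 * Real.pi / 2 - z = (Real.pi / 2 - z) + Real.pi by ring, Real.sin_add_pi,
    Real.cos_add_pi, Real.sin_pi_div_two_sub, Real.cos_pi_div_two_sub]
  ring

lemma sin_sub_mul_cos_pos_at : 0 < Real.sin 4.493409 - 4.493409 * Real.cos 4.493409 := by
  have p1 := Real.pi_gt_d20
  have p2 := Real.pi_lt_d20
  obtain ⟨z, hz⟩ : ∃ z, z = 3 * Real.pi / 2 - 4.493409 := ⟨_, rfl⟩
  have e := sin_sub_mul_cos_reflect z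
  rw [show 3 * Real.pi / 2 - z = 4.493409 by rw [hz]; ring] at e
  rw [e]
  -- A truncation of `3π/2 - 4.493409` from below; sine increases and cosine decreases there, so
  -- both estimates go the required way.
  have hz1 : 0.2189799803 ≤ z := by rw [hz]; linarith
  have hz2 : z ≤ 1 := by rw [hz]; linarith
  have s1 : Real.sin 0.2189799803 ≤ Real.sin z :=
    Real.sin_le_sin_of_le_of_le_pi_div_two (by linarith) (by linarith) hz1
  have c1 : Real.cos z ≤ Real.cos 0.2189799803 :=
    Real.cos_le_cos_of_nonneg_of_le_pi (by norm_num) (by linarith) hz1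
  have s2 := sin_ge_septic (x := 0.2189799803) (by norm_num)
  have c2 := cos_le_quartic (x := 0.2189799803) (by norm_num)
  norm_num at s2 c2 s1 c1 ⊢
  linarith

lemma sin_sub_mul_cos_neg_at : Real.sin 4.493410 - 4.493410 * Real.cos 4.493410 < 0 := by
  have p1 := Real.pi_gt_d20
  have p2 := Real.pi_lt_d20
  obtain ⟨z, hz⟩ : ∃ z, z = 3 * Real.pi / 2 - 4.493410 := ⟨_, rfl⟩
  have e := sin_sub_mul_cos_reflect z
  rw [show 3 * Real.pi / 2 - z = 4.493410 by rw [hz]; ring] at e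
  rw [e]
  have hz1 : z ≤ 0.2189789804 := by rw [hz]; linarith
  have hz0 : 0 ≤ z := by rw [hz]; linarith
  have s1 : Real.sin z ≤ Real.sin 0.2189789804 :=
    Real.sin_le_sin_of_le_of_le_pi_div_two (by linarith) (by linarith) hz1
  have c1 : Real.cos 0.2189789804 ≤ Real.cos z :=
    Real.cos_le_cos_of_nonneg_of_le_pi hz0 (by linarith) hz1
  have s2 := sin_le_quintic (x := 0.2189789804) (by norm_num)
  have c2 := cos_ge_sextic (x := 0.2189789804) (by norm_num)
  norm_num at s2 c2 s1 c1 ⊢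
  linarith

lemma exists_tan_eq_self :
    ∃ ρ : ℝ, ρ ∈ Ioo Real.pi (3 * Real.pi / 2) ∧ Real.sin ρ - ρ * Real.cos ρ = 0 ∧
      4.493409 ≤ ρ ∧ ρ < 4.493410 := by
  have p1 := Real.pi_gt_d20
  have p2 := Real.pi_lt_d20
  obtain ⟨ρ, h1, h2⟩ := intermediate_value_Icc' (f := fun x => Real.sin x - x * Real.cos x)
    (show (4.493409 : ℝ) ≤ 4.493410 by norm_num) (by fun_prop)
    ⟨sin_sub_mul_cos_neg_at.le, sin_sub_mul_cos_pos_at.le⟩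
  refine ⟨ρ, ⟨by linarith [h1.1], by linarith [h1.2]⟩, h2, h1.1, lt_of_le_of_ne h1.2 ?_⟩
  rintro rfl
  exact sin_sub_mul_cos_neg_at.ne h2

lemma xRoot_bounds_of_lt_third {m ρ : ℝ} (hm : m ∈ Ioo (0 : ℝ) (1 / 3))
    (hρ : ρ ∈ Ioo Real.pi (3 * Real.pi / 2)) (h : Real.sin ρ - ρ * Real.cos ρ = 0) :
    ρ < xRoot m ∧ Real.pi / (1 - m) < xRoot m ∧ xRoot m < 3 * Real.pi / 2 := by
  have hpi := Real.pi_pos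
  obtain ⟨h0, h1⟩ := hm
  have hI : m ∈ Ioo (0 : ℝ) 1 := ⟨h0, by linarith⟩
  have h1m : 0 < 1 - m := by linarith
  refine ⟨?_, ?_, ?_⟩
  · have hy0 : 0 < m * ρ := mul_pos h0 (by linarith [hρ.1])
    have hy1 : m * ρ < Real.pi / 2 := by nlinarith [hρ.1, hρ.2]
    have hc : Real.cos ρ < 0 :=
      Real.cos_neg_of_pi_div_two_lt_of_lt (by linarith [hρ.1]) (by linarith [hρ.2])
    have ht := Real.lt_tan hy0 hy1
    rw [Real.tan_eq_sin_div_cos,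
      lt_div_iff₀ (Real.cos_pos_of_mem_Ioo ⟨by linarith, hy1⟩)] at ht
    refine lt_xRoot_of_neg hI (by nlinarith [hρ.1, hρ.2]) ?_
    -- Since `sin ρ = ρ cos ρ`, the value at `ρ` factors, and its sign is decided by `tan t > t` at
    -- `t = m ρ < π / 2`.
    have : rootFn ρ m = Real.cos ρ * (Real.sin (m * ρ) - m * ρ * Real.cos (m * ρ)) := by
      unfold rootFn
      linear_combination (-m * Real.cos (m * ρ)) * h
    rw [this]
    exact mul_neg_of_neg_of_pos hc (by linarith)
  · refine pi_div_lt_xRoot_of_upper (k := 0) hI ?_ ?_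
    · rw [lt_div_iff₀ h1m]; push_cast; linarith
    · rw [div_lt_iff₀ h1m]; push_cast; linarith
  · refine xRoot_lt_of_pos hI (by linarith) ?_
    unfold rootFn
    rw [show 3 * Real.pi / 2 = Real.pi / 2 + Real.pi by ring, Real.sin_add_pi, Real.cos_add_pi,
      Real.sin_pi_div_two, Real.cos_pi_div_two]
    have : 0 < Real.cos (m * (Real.pi / 2 + Real.pi)) :=
      Real.cos_pos_of_mem_Ioo ⟨by nlinarith, by nlinarith⟩
    nlinarith

/-! ### Bounds on the offset of the root from `π / (1 - m)`. -/

/-- The sign of this function of `δ` decides on which side of the root the point at distance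
`π δ / (1 + m)` from `π / (1 - m)` lies, where `a = (1 + m) / (1 - m)` and `ε` is the distance from
`a` to the nearest odd integer. -/
noncomputable def offsetFn (a ε δ : ℝ) : ℝ :=
  a * Real.sin (Real.pi * δ / a) - Real.sin (Real.pi * (δ + ε))

/-- Monotonicity of `t ↦ t sin (v / t)`, which reduces the cube-root bound to the case `a = 2`. -/
lemma sin_le_mul_sin_div {a b v : ℝ} (hb : 0 < b) (hab : b ≤ a) (hv : 0 < v)
    (hvb : v / b ≤ Real.pi) : b * Real.sin (v / b) ≤ a * Real.sin (v / a) := by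
  rcases hab.eq_or_lt with rfl | hlt
  · exact le_rfl
  · have ha : 0 < a := hb.trans hlt
    have h := mul_sin_lt_mul_sin (u := v / a) (v := v / b) (by positivity)
      (by gcongr) hvb
    rw [div_mul_eq_mul_div, div_mul_eq_mul_div, div_lt_div_iff₀ ha hb, mul_assoc, mul_assoc] at h
    have := lt_of_mul_lt_mul_left h hv.le
    linarith

lemma offsetFn_pos_half {a ε : ℝ} (ha : 2 ≤ a) (h0 : 0 < ε) (h1 : ε < 1) :
    0 < offsetFn a ε ((1 - ε) / 2) := by
  have hpi := Real.pi_pos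
  unfold offsetFn
  -- For `δ = (1 - ε) / 2` the angles `π δ` and `π (δ + ε)` are symmetric about `π / 2`.
  have e : Real.sin (Real.pi * ((1 - ε) / 2 + ε)) = Real.sin (Real.pi * ((1 - ε) / 2)) := by
    rw [← Real.sin_pi_sub]; congr 1; ring
  rw [e]
  set v := Real.pi * ((1 - ε) / 2) with hv
  have hv0 : 0 < v := by apply mul_pos hpi; linarith
  have hv1 : v < Real.pi := by rw [hv]; nlinarith
  have h2 := mul_sin_lt_mul_sin (u := v / a) (v := v) (by positivity)
    (div_lt_self hv0 (by linarith)) hv1.le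
  rw [div_mul_eq_mul_div, div_lt_iff₀ (by linarith), mul_assoc v] at h2
  have := lt_of_mul_lt_mul_left h2 hv0.le
  linarith

lemma sin_add_cube_lt {c : ℝ} (h0 : 0 < c) (h1 : c < 1 / 2) :
    Real.sin (Real.pi * (c + c ^ 3)) < 2 * Real.sin (Real.pi * c / 2) := by
  have hpi := Real.pi_gt_three
  have hpi' := Real.pi_lt_d2
  set y := Real.pi * c / 2 with hy
  have hy0 : 0 < y := by rw [hy]; positivity
  have hy1 : y < Real.pi / 4 := by rw [hy]; nlinarith
  set z := Real.pi * c ^ 3 with hz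
  have hz0 : 0 < z := by rw [hz]; positivity
  rw [show Real.pi * (c + c ^ 3) = 2 * y + z by rw [hy, hz]; ring, Real.sin_add,
    Real.sin_two_mul]
  have hcos2 : 0 < Real.cos (2 * y) := Real.cos_pos_of_mem_Ioo ⟨by linarith, by linarith⟩
  have hs : 0 < Real.sin y := Real.sin_pos_of_pos_of_lt_pi hy0 (by linarith)
  have hc : 0 < Real.cos y := Real.cos_pos_of_mem_Ioo ⟨by linarith, by linarith⟩
  have e1 : 2 * Real.sin y * Real.cos y * Real.cos z ≤ 2 * Real.sin y * Real.cos y :=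
    mul_le_of_le_one_right (by positivity) (Real.cos_le_one z)
  have e2 : Real.cos (2 * y) * Real.sin z ≤ Real.cos (2 * y) * z := by
    gcongr; exact (Real.sin_lt hz0).le
  -- This uses `π² ≥ 8`. The claim then reduces to `cos (2 y) * y ^ 3 < 2 sin y (1 - cos y)`, whose
  -- two sides agree to third order and differ by about `3 y ^ 5 / 4`.
  have hzy : z ≤ y ^ 3 := by
    rw [hy, hz, show (Real.pi * c / 2) ^ 3 = Real.pi * c ^ 3 * (Real.pi ^ 2 / 8) by ring]
    exact le_mul_of_one_le_right (by positivity) (by nlinarith)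
  have e3 : Real.cos (2 * y) * z ≤ Real.cos (2 * y) * y ^ 3 := by gcongr
  have hq : y ^ 2 ≤ 0.64 := by nlinarith
  have hsl : y * (1 - y ^ 2 / 6) ≤ Real.sin y := by
    have := sin_ge_cubic hy0.le
    linarith
  have hcu := cos_le_quartic hy0.le
  have hc2 : Real.cos (2 * y) ≤ 1 - y ^ 2 := by
    have := cos_le_quartic (x := 2 * y) (by linarith)
    nlinarith
  have e4 : Real.cos (2 * y) * y ^ 3 ≤ (1 - y ^ 2) * y ^ 3 := by gcongr
  have hd : y ^ 2 / 2 * (1 - y ^ 2 / 12) ≤ 1 - Real.cos y := by linarith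
  have e5 : (y * (1 - y ^ 2 / 6)) * (y ^ 2 / 2 * (1 - y ^ 2 / 12)) ≤
      Real.sin y * (1 - Real.cos y) := by
    apply mul_le_mul hsl hd _ hs.le
    have : 0 ≤ 1 - y ^ 2 / 12 := by linarith
    positivity
  have e6 : (1 - y ^ 2) * y ^ 3 < 2 * ((y * (1 - y ^ 2 / 6)) * (y ^ 2 / 2 * (1 - y ^ 2 / 12))) := by
    have : 0 < y ^ 5 * (3 / 4 + y ^ 2 / 72) := by positivity
    linear_combination this
  linarith

lemma offsetFn_pos_cube {a c : ℝ} (ha : 2 ≤ a) (h0 : 0 < c) (h1 : c ≤ (1 - c ^ 3) / 2) :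
    0 < offsetFn a (c ^ 3) c := by
  have hpi := Real.pi_pos
  have hc3 : 0 < c ^ 3 := by positivity
  have := sin_add_cube_lt h0 (by linarith)
  have h2 := sin_le_mul_sin_div (v := Real.pi * c) two_pos ha (by positivity) (by nlinarith)
  unfold offsetFn
  linarith

lemma arcsin_bounds {a : ℝ} (ha : 1 < a) :
    0 < a / Real.pi * Real.arcsin (1 / a) ∧ a / Real.pi * Real.arcsin (1 / a) < 1 / 2 := by
  have hpi := Real.pi_pos
  have ha0 : 0 < a := by linarith
  have hr : 0 < 1 / a := by positivity
  have hr1 : 1 / a < 1 := by rw [div_lt_one ha0]; exact ha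
  have h0 : 0 < Real.arcsin (1 / a) := Real.arcsin_pos.2 hr
  -- Jordan's inequality `2 α / π < sin α` at `α = arcsin (1 / a)`.
  have h1 := Real.mul_lt_sin h0 (Real.arcsin_lt_pi_div_two.2 hr1)
  rw [Real.sin_arcsin (by linarith) hr1.le] at h1
  refine ⟨by positivity, ?_⟩
  rw [lt_div_iff₀ ha0] at h1
  calc a / Real.pi * Real.arcsin (1 / a)
      = (2 / Real.pi * Real.arcsin (1 / a) * a) / 2 := by ring
    _ < 1 / 2 := by gcongr

/-- This `δ` makes `a sin (π δ / a)` equal to `1`, the maximum of the subtracted sine. Hence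
nonnegativity is automatic, with zero only at `δ + ε = 1 / 2`. -/
lemma offsetFn_arcsin {a : ℝ} (ha : 1 < a) (ε : ℝ) :
    offsetFn a ε (a / Real.pi * Real.arcsin (1 / a)) =
      1 - Real.sin (Real.pi * (a / Real.pi * Real.arcsin (1 / a) + ε)) := by
  have hpi := Real.pi_pos
  have ha0 : 0 < a := by linarith
  have hr1 : 1 / a < 1 := by rw [div_lt_one ha0]; exact ha
  have e : Real.pi * (a / Real.pi * Real.arcsin (1 / a)) / a = Real.arcsin (1 / a) := by
    field_simp
  have h0 : 0 < 1 / a := by positivity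
  unfold offsetFn
  rw [e, Real.sin_arcsin (by linarith) hr1.le, mul_one_div_cancel ha0.ne']

lemma sin_eq_one_iff_half {s : ℝ} (h0 : 0 < s) (h1 : s < 3 / 2) :
    Real.sin (Real.pi * s) = 1 ↔ s = 1 / 2 := by
  have hpi := Real.pi_pos
  constructor
  · intro h
    rw [← Real.cos_sub_pi_div_two,
      Real.cos_eq_one_iff_of_lt_of_lt (by nlinarith) (by nlinarith)] at h
    refine mul_left_cancel₀ hpi.ne' ?_
    linarith
  · rintro rfl
    rw [mul_one_div, Real.sin_pi_div_two]

/-- If `δ₀` is located by the sign of `offsetFn`, the three bounds on it hold, and only the third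
one can be attained. -/
lemma offset_bounds {a ε δ₀ : ℝ} (ha : 2 ≤ a) (h0 : 0 < ε) (h1 : ε < 1)
    (hpos : ∀ δ, 0 < δ → δ < 1 / 2 → 0 < offsetFn a ε δ → δ₀ < δ)
    (hzero : ∀ δ, 0 < δ → δ < 1 / 2 → offsetFn a ε δ = 0 → δ₀ = δ) :
    δ₀ < (1 - ε) / 2 ∧ δ₀ < ε ^ ((1 : ℝ) / 3) ∧ δ₀ ≤ a / Real.pi * Real.arcsin (1 / a) ∧
      (δ₀ = a / Real.pi * Real.arcsin (1 / a) ↔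
        a / Real.pi * Real.arcsin (1 / a) + ε = 1 / 2) := by
  have hb := hpos ((1 - ε) / 2) (by linarith) (by linarith) (offsetFn_pos_half ha h0 h1)
  obtain ⟨c1, c2⟩ := arcsin_bounds (show 1 < a by linarith)
  have e := offsetFn_arcsin (show 1 < a by linarith) ε
  have hs := sin_eq_one_iff_half (s := a / Real.pi * Real.arcsin (1 / a) + ε)
    (by linarith) (by linarith)
  have hle := Real.sin_le_one (Real.pi * (a / Real.pi * Real.arcsin (1 / a) + ε))
  refine ⟨hb, ?_, ?_, ?_⟩
  -- The cube root matters only when it is at most `(1 - ε) / 2`, which also keeps it below `1 / 2`.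
  · rcases lt_or_ge ((1 - ε) / 2) (ε ^ ((1 : ℝ) / 3)) with h | h
    · exact hb.trans h
    · have hc : (ε ^ ((1 : ℝ) / 3)) ^ 3 = ε := by
        rw [← Real.rpow_natCast, ← Real.rpow_mul h0.le]; norm_num
      have hc0 : 0 < ε ^ ((1 : ℝ) / 3) := Real.rpow_pos_of_pos h0 _
      have := offsetFn_pos_cube ha hc0 (by rw [hc]; exact h)
      rw [hc] at this
      exact hpos _ hc0 (by linarith) this
  · rcases hle.lt_or_eq with h | h
    · exact (hpos _ c1 c2 (by rw [e]; linarith)).le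
    · exact (hzero _ c1 c2 (by rw [e]; linarith)).le
  · rw [← hs]
    constructor
    · intro h
      by_contra hne
      have := hpos _ c1 c2 (by rw [e]; linarith [lt_of_le_of_ne hle hne])
      linarith
    · intro h
      exact hzero _ c1 c2 (by rw [e]; linarith)

lemma arcsin_term_eq {m : ℝ} :
    (1 + m) / (Real.pi * (1 - m)) * Real.arcsin ((1 - m) / (1 + m)) =
      (1 + m) / (1 - m) / Real.pi * Real.arcsin (1 / ((1 + m) / (1 - m))) := by
  rw [one_div_div, div_div, mul_comm Real.pi]

/-- `2 rootFn` at an offset `δ` from `π / (1 - m)`. -/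
lemma two_mul_rootFn_offset {m : ℝ} (hm : m ∈ Ioo (0 : ℝ) 1) (δ : ℝ) :
    2 * rootFn (Real.pi / (1 - m) + Real.pi / (1 + m) * δ) m =
      (1 - m) * (Real.sin ((1 + m) / (1 - m) * Real.pi + Real.pi * δ) +
        (1 + m) / (1 - m) * Real.sin (Real.pi * δ / ((1 + m) / (1 - m)))) := by
  have h1 : 1 - m ≠ 0 := by linarith [hm.2]
  have h2 : 1 + m ≠ 0 := by linarith [hm.1]
  have e1 : (1 + m) * (Real.pi / (1 - m) + Real.pi / (1 + m) * δ) =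
      (1 + m) / (1 - m) * Real.pi + Real.pi * δ := by field_simp
  have e2 : (1 - m) * (Real.pi / (1 - m) + Real.pi / (1 + m) * δ) =
      Real.pi * δ / ((1 + m) / (1 - m)) + Real.pi := by field_simp; ring
  rw [two_mul_rootFn, e1, e2, Real.sin_add_pi]
  field_simp
  ring

/-- To the left of `π / (1 - m)` the sign is opposite to that of `offsetFn`, to the right it agrees.
Either way, positive `offsetFn` at `δ` means that the root is closer than `δ`. -/
lemma two_mul_rootFn_offset_lower {m : ℝ} (hm : m ∈ Ioo (0 : ℝ) 1) (k : ℕ) (δ : ℝ) :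
    2 * rootFn (Real.pi / (1 - m) - Real.pi / (1 + m) * δ) m =
      -((1 - m) * offsetFn ((1 + m) / (1 - m)) (2 * k + 1 - (1 + m) / (1 - m)) δ) := by
  have e := two_mul_rootFn_offset hm (-δ)
  rw [mul_neg, ← sub_eq_add_neg, mul_neg, neg_div, Real.sin_neg] at e
  rw [e]
  have : Real.sin ((1 + m) / (1 - m) * Real.pi + -(Real.pi * δ)) =
      Real.sin (Real.pi * (δ + (2 * k + 1 - (1 + m) / (1 - m)))) := by
    rw [← Real.sin_pi_sub, ← Real.sin_add_nat_mul_two_pi _ k]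
    congr 1; ring
  rw [this]
  unfold offsetFn
  ring

lemma two_mul_rootFn_offset_upper {m : ℝ} (hm : m ∈ Ioo (0 : ℝ) 1) (k : ℕ) (δ : ℝ) :
    2 * rootFn (Real.pi / (1 - m) + Real.pi / (1 + m) * δ) m =
      (1 - m) * offsetFn ((1 + m) / (1 - m)) ((1 + m) / (1 - m) - (2 * k + 1)) δ := by
  rw [two_mul_rootFn_offset hm δ]
  have : Real.sin ((1 + m) / (1 - m) * Real.pi + Real.pi * δ) =
      -Real.sin (Real.pi * (δ + ((1 + m) / (1 - m) - (2 * k + 1)))) := by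
    rw [← Real.sin_add_pi, ← Real.sin_add_nat_mul_two_pi (_ + Real.pi) k]
    congr 1; ring
  rw [this]
  unfold offsetFn
  ring

lemma offset_mem_window {m δ : ℝ} (hm : m ∈ Ioo (0 : ℝ) 1) (h0 : 0 < δ) (h1 : δ < 1 / 2) :
    0 < Real.pi / (1 - m) - Real.pi / (1 + m) * δ ∧
      (1 - m) * (Real.pi / (1 - m) + Real.pi / (1 + m) * δ) ≤ 3 * Real.pi / 2 := by
  have hpi := Real.pi_pos
  obtain ⟨hm0, hm1⟩ := hm
  have h1m : 0 < 1 - m := by linarith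
  have h2m : 0 < 1 + m := by linarith
  have hlt : Real.pi / (1 + m) < Real.pi / (1 - m) := by gcongr; linarith
  have hp : 0 < Real.pi / (1 + m) := by positivity
  refine ⟨by nlinarith, ?_⟩
  have e : (1 - m) * (Real.pi / (1 - m)) = Real.pi := by field_simp
  have h3 : Real.pi / (1 + m) ≤ Real.pi := div_le_self hpi.le (by linarith)
  have h4 : Real.pi / (1 + m) * δ ≤ Real.pi * (1 / 2) := by gcongr
  have h5 : (1 - m) * (Real.pi / (1 + m) * δ) ≤ Real.pi / (1 + m) * δ :=
    mul_le_of_le_one_left (by positivity) (by linarith)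
  rw [mul_add, e]
  linarith

lemma xRoot_lower_bound {k : ℕ} (hk : 1 ≤ k) {m : ℝ}
    (hm : m ∈ Ioo ((2 * (k : ℝ) - 1) / (2 * k + 1)) ((k : ℝ) / (k + 1))) :
    Real.pi / (1 - m) - Real.pi / (1 + m) * h₁ k m ≤ xRoot m ∧
      (xRoot m = Real.pi / (1 - m) - Real.pi / (1 + m) * h₁ k m ↔
        (1 + m) / (Real.pi * (1 - m)) * Real.arcsin ((1 - m) / (1 + m)) +
          (2 * k + 1 - (1 + m) / (1 - m)) = 1 / 2) := by
  obtain ⟨hI, ha1, ha2⟩ := mem_lower_interval hk hm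
  have hk' : (1 : ℝ) ≤ k := by exact_mod_cast hk
  have hpi := Real.pi_pos
  have h1m : 0 < 1 - m := by linarith [hI.2]
  have h2m : 0 < 1 + m := by linarith [hI.1]
  have hr : 0 < Real.pi / (1 + m) := by positivity
  obtain ⟨δ₀, hδ⟩ : ∃ δ₀, xRoot m = Real.pi / (1 - m) - Real.pi / (1 + m) * δ₀ :=
    ⟨(Real.pi / (1 - m) - xRoot m) / (Real.pi / (1 + m)), by
      rw [mul_div_cancel₀ _ hr.ne']; ring⟩
  obtain ⟨b1, b2, b3, b4⟩ := offset_bounds (a := (1 + m) / (1 - m))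
    (ε := 2 * k + 1 - (1 + m) / (1 - m)) (δ₀ := δ₀) (by linarith) (by linarith) (by linarith)
    (fun δ h0 h1 h => by
      have e := two_mul_rootFn_offset_lower hI k δ
      have := mul_pos h1m h
      have hw := (offset_mem_window hI h0 h1).2
      have hlt := lt_xRoot_of_neg hI (y := Real.pi / (1 - m) - Real.pi / (1 + m) * δ)
        (le_trans (by gcongr; nlinarith) hw) (by linarith)
      rw [hδ] at hlt
      exact lt_of_mul_lt_mul_left (by linarith) hr.le)
    (fun δ h0 h1 h => by
      have e := two_mul_rootFn_offset_lower hI k δ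
      rw [h, mul_zero, neg_zero] at e
      obtain ⟨hw0, hw⟩ := offset_mem_window hI h0 h1
      have heq := xRoot_eq_of_eq_zero hI hw0
        (le_trans (by gcongr; nlinarith) hw) (by linarith)
      rw [hδ] at heq
      exact mul_left_cancel₀ hr.ne' (by linarith))
  have hh : h₁ k m = min ((1 - (2 * k + 1 - (1 + m) / (1 - m))) / 2)
      (min ((2 * k + 1 - (1 + m) / (1 - m)) ^ ((1 : ℝ) / 3))
        ((1 + m) / (1 - m) / Real.pi * Real.arcsin (1 / ((1 + m) / (1 - m))))) := by
    unfold h₁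
    rw [arcsin_term_eq]
    congr 1
    field_simp; ring
  rw [arcsin_term_eq, ← b4, hδ, hh]
  refine ⟨?_, ?_⟩
  · gcongr
    exact le_min b1.le (le_min b2.le b3)
  · rw [sub_right_inj, mul_right_inj' hr.ne']
    constructor
    -- The other two bounds on `δ₀` are strict, so equality with the minimum can come only from the
    -- arcsine term.
    · intro h
      rcases min_choice ((1 - (2 * k + 1 - (1 + m) / (1 - m))) / 2)
        (min ((2 * k + 1 - (1 + m) / (1 - m)) ^ ((1 : ℝ) / 3))
        ((1 + m) / (1 - m) / Real.pi * Real.arcsin (1 / ((1 + m) / (1 - m))))) with h' | h' <;>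
        rw [h'] at h
      · linarith
      · rcases min_choice ((2 * k + 1 - (1 + m) / (1 - m)) ^ ((1 : ℝ) / 3))
          ((1 + m) / (1 - m) / Real.pi * Real.arcsin (1 / ((1 + m) / (1 - m)))) with h'' | h'' <;>
          rw [h''] at h
        · linarith
        · exact h
    · intro h
      rw [← h, min_eq_right b2.le, min_eq_right b1.le]

lemma xRoot_upper_bound {k : ℕ} (hk : 1 ≤ k) {m : ℝ}
    (hm : m ∈ Ioo ((k : ℝ) / (k + 1)) ((2 * (k : ℝ) + 1) / (2 * k + 3))) :
    xRoot m ≤ Real.pi / (1 - m) + Real.pi / (1 + m) * h₂ k m ∧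
      (xRoot m = Real.pi / (1 - m) + Real.pi / (1 + m) * h₂ k m ↔
        (1 + m) / (Real.pi * (1 - m)) * Real.arcsin ((1 - m) / (1 + m)) +
          ((1 + m) / (1 - m) - (2 * k + 1)) = 1 / 2) := by
  obtain ⟨hI, ha1, ha2⟩ := mem_upper_interval hm
  have hk' : (1 : ℝ) ≤ k := by exact_mod_cast hk
  have hpi := Real.pi_pos
  have h1m : 0 < 1 - m := by linarith [hI.2]
  have h2m : 0 < 1 + m := by linarith [hI.1]
  have hr : 0 < Real.pi / (1 + m) := by positivity
  obtain ⟨δ₀, hδ⟩ : ∃ δ₀, xRoot m = Real.pi / (1 - m) + Real.pi / (1 + m) * δ₀ :=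
    ⟨(xRoot m - Real.pi / (1 - m)) / (Real.pi / (1 + m)), by
      rw [mul_div_cancel₀ _ hr.ne']; ring⟩
  obtain ⟨b1, b2, b3, b4⟩ := offset_bounds (a := (1 + m) / (1 - m))
    (ε := (1 + m) / (1 - m) - (2 * k + 1)) (δ₀ := δ₀) (by linarith) (by linarith) (by linarith)
    (fun δ h0 h1 h => by
      have e := two_mul_rootFn_offset_upper hI k δ
      have := mul_pos h1m h
      have hlt := xRoot_lt_of_pos hI (y := Real.pi / (1 - m) + Real.pi / (1 + m) * δ)
        (by positivity) (by linarith)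
      rw [hδ] at hlt
      exact lt_of_mul_lt_mul_left (by linarith) hr.le)
    (fun δ h0 h1 h => by
      have e := two_mul_rootFn_offset_upper hI k δ
      rw [h, mul_zero] at e
      have heq := xRoot_eq_of_eq_zero hI (y := Real.pi / (1 - m) + Real.pi / (1 + m) * δ)
        (by positivity) (offset_mem_window hI h0 h1).2 (by linarith)
      rw [hδ] at heq
      exact mul_left_cancel₀ hr.ne' (by linarith))
  have hh : h₂ k m = min (((1 + m) / (1 - m) - (2 * k + 1)) ^ ((1 : ℝ) / 3))
      (min ((1 - ((1 + m) / (1 - m) - (2 * k + 1))) / 2)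
        ((1 + m) / (1 - m) / Real.pi * Real.arcsin (1 / ((1 + m) / (1 - m))))) := by
    unfold h₂
    rw [arcsin_term_eq]
    congr 2
    field_simp; ring
  rw [arcsin_term_eq, ← b4, hδ, hh]
  refine ⟨?_, ?_⟩
  · gcongr
    exact le_min b2.le (le_min b1.le b3)
  · rw [add_right_inj, mul_right_inj' hr.ne']
    constructor
    · intro h
      rcases min_choice (((1 + m) / (1 - m) - (2 * k + 1)) ^ ((1 : ℝ) / 3))
        (min ((1 - ((1 + m) / (1 - m) - (2 * k + 1))) / 2)
        ((1 + m) / (1 - m) / Real.pi * Real.arcsin (1 / ((1 + m) / (1 - m))))) with h' | h' <;>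
        rw [h'] at h
      · linarith
      · rcases min_choice ((1 - ((1 + m) / (1 - m) - (2 * k + 1))) / 2)
          ((1 + m) / (1 - m) / Real.pi * Real.arcsin (1 / ((1 + m) / (1 - m)))) with h'' | h'' <;>
          rw [h''] at h
        · linarith
        · exact h
    · intro h
      rw [← h, min_eq_right b1.le, min_eq_right b2.le]

/-! ### Exactly one point of equality in each interval. -/

lemma arcsin_ratio_spec {m : ℝ} (hm : m ∈ Ioo (0 : ℝ) 1) :
    Real.sin (Real.arcsin ((1 - m) / (1 + m))) = (1 - m) / (1 + m) ∧
      0 < Real.arcsin ((1 - m) / (1 + m)) ∧ Real.arcsin ((1 - m) / (1 + m)) < Real.pi / 2 := by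
  have h1m : 0 < 1 - m := by linarith [hm.2]
  have h2m : 0 < 1 + m := by linarith [hm.1]
  have hr : 0 < (1 - m) / (1 + m) := by positivity
  have hr1 : (1 - m) / (1 + m) < 1 := by rw [div_lt_one h2m]; linarith [hm.1]
  exact ⟨Real.sin_arcsin (by linarith) hr1.le, Real.arcsin_pos.2 hr,
    Real.arcsin_lt_pi_div_two.2 hr1⟩

lemma eq_of_arcsin_ratio_eq {m m' : ℝ} (hm : m ∈ Ioo (0 : ℝ) 1) (hm' : m' ∈ Ioo (0 : ℝ) 1)
    (h : Real.arcsin ((1 - m) / (1 + m)) = Real.arcsin ((1 - m') / (1 + m'))) : m = m' := by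
  have e := (arcsin_ratio_spec hm).1
  rw [h, (arcsin_ratio_spec hm').1, div_eq_div_iff (by linarith [hm'.1]) (by linarith [hm.1])] at e
  linarith

/-- With `α = arcsin ((1 - m) / (1 + m))` one has `(1 + m) / (1 - m) = 1 / sin α`, so multiplying by
`π sin α` leaves an equation in `α` alone. -/
lemma ratio_term_eq_iff {m c d : ℝ} (hm : m ∈ Ioo (0 : ℝ) 1) :
    (1 + m) / (Real.pi * (1 - m)) * Real.arcsin ((1 - m) / (1 + m)) +
        c * ((1 + m) / (1 - m)) = d ↔
      Real.arcsin ((1 - m) / (1 + m)) + c * Real.pi =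
        d * Real.pi * Real.sin (Real.arcsin ((1 - m) / (1 + m))) := by
  rw [(arcsin_ratio_spec hm).1]
  have hpi := Real.pi_ne_zero
  have h1m : 1 - m ≠ 0 := by linarith [hm.2]
  have h2m : 1 + m ≠ 0 := by linarith [hm.1]
  generalize Real.arcsin ((1 - m) / (1 + m)) = α
  constructor
  · intro h
    rw [← h]
    field_simp
  · intro h
    field_simp at h ⊢
    linarith

lemma continuousOn_arcsin_term {s : Set ℝ} (hs : ∀ m ∈ s, m ∈ Ioo (0 : ℝ) 1) (c d : ℝ) :
    ContinuousOn (fun m : ℝ => (1 + m) / (Real.pi * (1 - m)) *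
      Real.arcsin ((1 - m) / (1 + m)) + (c * ((1 + m) / (1 - m)) + d)) s := by
  have hpi := Real.pi_ne_zero
  have h1 : ∀ m ∈ s, 1 - m ≠ 0 := fun m hm => by linarith [(hs m hm).2]
  have h2 : ∀ m ∈ s, 1 + m ≠ 0 := fun m hm => by linarith [(hs m hm).1]
  have h3 : ContinuousOn (fun m : ℝ => (1 - m) / (1 + m)) s :=
    ContinuousOn.div (by fun_prop) (by fun_prop) h2
  have h4 : ContinuousOn (fun m : ℝ => (1 + m) / (1 - m)) s :=
    ContinuousOn.div (by fun_prop) (by fun_prop) h1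
  have h5 : ContinuousOn (fun m : ℝ => (1 + m) / (Real.pi * (1 - m))) s :=
    ContinuousOn.div (by fun_prop) (by fun_prop) fun m hm => mul_ne_zero hpi (h1 m hm)
  exact (h5.mul (Real.continuous_arcsin.comp_continuousOn h3)).add
    ((continuousOn_const.mul h4).add continuousOn_const)

lemma arcsin_term_bounds {m : ℝ} (hm : m ∈ Ioo (0 : ℝ) 1) :
    0 < (1 + m) / (Real.pi * (1 - m)) * Real.arcsin ((1 - m) / (1 + m)) ∧
      (1 + m) / (Real.pi * (1 - m)) * Real.arcsin ((1 - m) / (1 + m)) < 1 / 2 := by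
  rw [arcsin_term_eq]
  exact arcsin_bounds (by rw [one_lt_div] <;> linarith [hm.1, hm.2])

lemma ratio_div_self_add {x y : ℝ} (hxy : x + y ≠ 0) :
    (1 + x / (x + y)) / (1 - x / (x + y)) = (2 * x + y) / y := by
  rw [one_add_div hxy, one_sub_div hxy, div_div_div_cancel_right₀ hxy, add_sub_cancel_left]
  congr 1; ring

lemma existsUnique_lower {k : ℕ} (hk : 1 ≤ k) :
    ∃! m : ℝ, m ∈ Ioo ((2 * (k : ℝ) - 1) / (2 * k + 1)) ((k : ℝ) / (k + 1)) ∧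
      (1 + m) / (Real.pi * (1 - m)) * Real.arcsin ((1 - m) / (1 + m)) +
        (2 * k + 1 - (1 + m) / (1 - m)) = 1 / 2 := by
  have hpi := Real.pi_pos
  have hk' : (1 : ℝ) ≤ k := by exact_mod_cast hk
  set L := (2 * (k : ℝ) - 1) / (2 * k + 1) with hL
  set R := (k : ℝ) / (k + 1) with hR
  have hRI : R ∈ Ioo (0 : ℝ) 1 := div_add_mem_Ioo hk one_pos
  have hLR : L < R := by
    rw [hL, hR, div_lt_div_iff₀ (by positivity) (by positivity)]; linarith
  have hLI : L ∈ Ioo (0 : ℝ) 1 := ⟨by apply div_pos <;> linarith, hLR.trans hRI.2⟩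
  have hLa : (1 + L) / (1 - L) = 2 * k := by
    rw [hL, show 2 * (k : ℝ) + 1 = (2 * k - 1) + 2 by ring,
      ratio_div_self_add (ne_of_gt (by linarith))]
    ring
  have hRa : (1 + R) / (1 - R) = 2 * k + 1 := by
    rw [hR, ratio_div_self_add (by positivity), div_one]
  have hsub : ∀ m ∈ Icc L R, m ∈ Ioo (0 : ℝ) 1 := fun m hm =>
    ⟨hLI.1.trans_le hm.1, hm.2.trans_lt hRI.2⟩
  have hLb := arcsin_term_bounds hLI
  have hRb := arcsin_term_bounds hRI
  -- The arcsine term lies in `(0, 1/2)`, while `2k + 1 - a` runs from `1` at `L` to `0` at `R`.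
  obtain ⟨m, hm, hme⟩ := intermediate_value_Icc' hLR.le
    (continuousOn_arcsin_term hsub (-1) (2 * k + 1))
    (show (1 / 2 : ℝ) ∈ Icc _ _ from ⟨by rw [hRa]; linarith, by rw [hLa]; linarith⟩)
  have key : ∀ m ∈ Ioo (0 : ℝ) 1, (1 + m) / (Real.pi * (1 - m)) * Real.arcsin ((1 - m) / (1 + m)) +
        (2 * k + 1 - (1 + m) / (1 - m)) = 1 / 2 →
      Real.pi - Real.arcsin ((1 - m) / (1 + m)) =
        (2 * k + 1 / 2) * Real.pi * Real.sin (Real.arcsin ((1 - m) / (1 + m))) := by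
    intro m hm h
    have := (ratio_term_eq_iff (c := -1) (d := -(2 * k + 1 / 2)) hm).1 (by linarith)
    linarith
  -- In `π - α = (2k + 1/2) π sin α` the left side decreases and the right side increases on `(0,
  -- π/2)`.
  have hlt : ∀ m ∈ Ioo (0 : ℝ) 1, ∀ m' ∈ Ioo (0 : ℝ) 1,
      Real.pi - Real.arcsin ((1 - m) / (1 + m)) =
        (2 * k + 1 / 2) * Real.pi * Real.sin (Real.arcsin ((1 - m) / (1 + m))) →
      Real.pi - Real.arcsin ((1 - m') / (1 + m')) =
        (2 * k + 1 / 2) * Real.pi * Real.sin (Real.arcsin ((1 - m') / (1 + m'))) →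
      ¬ Real.arcsin ((1 - m) / (1 + m)) < Real.arcsin ((1 - m') / (1 + m')) := by
    intro m hm m' hm' h h' hlt
    have h1 := (arcsin_ratio_spec hm).2
    have h2 := (arcsin_ratio_spec hm').2
    have h3 := Real.sin_lt_sin_of_lt_of_le_pi_div_two (by linarith) h2.2.le hlt
    have h4 : 0 < (2 * (k : ℝ) + 1 / 2) * Real.pi := by positivity
    have := mul_lt_mul_of_pos_left h3 h4
    linarith
  refine ⟨m, ⟨⟨lt_of_le_of_ne hm.1 ?_, lt_of_le_of_ne hm.2 ?_⟩, ?_⟩, ?_⟩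
  · rintro rfl
    simp only [hLa] at hme
    linarith
  · rintro rfl
    simp only [hRa] at hme
    linarith
  · linarith
  · rintro m' ⟨hm', hme'⟩
    have hI := hsub m hm
    have hI' := hsub m' ⟨hm'.1.le, hm'.2.le⟩
    have e := key m hI (by linarith)
    have e' := key m' hI' hme'
    exact eq_of_arcsin_ratio_eq hI' hI
      (le_antisymm (not_lt.1 (hlt m hI m' hI' e e')) (not_lt.1 (hlt m' hI' m hI e' e)))

/-- On this range `cos x ≥ 1 / 2`, so `c > 2` makes the derivative positive. -/
lemma strictMonoOn_mul_sin_sub {c : ℝ} (hc : 2 < c) :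
    StrictMonoOn (fun x => c * Real.sin x - x) (Icc 0 (Real.pi / 3)) := by
  have hpi := Real.pi_pos
  have hd : ∀ x, HasDerivAt (fun x => c * Real.sin x - x) (c * Real.cos x - 1) x := fun x =>
    ((Real.hasDerivAt_sin x).const_mul c).sub (hasDerivAt_id x)
  refine strictMonoOn_of_deriv_pos (convex_Icc _ _)
    (fun y _ => (hd y).continuousAt.continuousWithinAt) fun y hy => ?_
  rw [interior_Icc] at hy
  rw [(hd y).deriv]
  have := Real.cos_le_cos_of_nonneg_of_le_pi hy.1.le (by linarith) hy.2.le
  rw [Real.cos_pi_div_three] at this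
  nlinarith

lemma existsUnique_upper {k : ℕ} (hk : 1 ≤ k) :
    ∃! m : ℝ, m ∈ Ioo ((k : ℝ) / (k + 1)) ((2 * (k : ℝ) + 1) / (2 * k + 3)) ∧
      (1 + m) / (Real.pi * (1 - m)) * Real.arcsin ((1 - m) / (1 + m)) +
        ((1 + m) / (1 - m) - (2 * k + 1)) = 1 / 2 := by
  have hpi := Real.pi_gt_three
  have hk' : (1 : ℝ) ≤ k := by exact_mod_cast hk
  set L := (k : ℝ) / (k + 1) with hL
  set R := (2 * (k : ℝ) + 1) / (2 * k + 3) with hR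
  have hLI : L ∈ Ioo (0 : ℝ) 1 := div_add_mem_Ioo hk one_pos
  have hLR : L < R := by
    rw [hL, hR, div_lt_div_iff₀ (by positivity) (by positivity)]; linarith
  have hRI : R ∈ Ioo (0 : ℝ) 1 := ⟨by positivity, by rw [hR, div_lt_one] <;> linarith⟩
  have hLa : (1 + L) / (1 - L) = 2 * k + 1 := by
    rw [hL, ratio_div_self_add (by positivity), div_one]
  have hRa : (1 + R) / (1 - R) = 2 * k + 2 := by
    rw [hR, show 2 * (k : ℝ) + 3 = (2 * k + 1) + 2 by ring,
      ratio_div_self_add (by positivity)]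
    ring
  have hsub : ∀ m ∈ Icc L R, m ∈ Ioo (0 : ℝ) 1 := fun m hm =>
    ⟨hLI.1.trans_le hm.1, hm.2.trans_lt hRI.2⟩
  have hLb := arcsin_term_bounds hLI
  have hRb := arcsin_term_bounds hRI
  obtain ⟨m, hm, hme⟩ := intermediate_value_Icc hLR.le
    (continuousOn_arcsin_term hsub 1 (-(2 * k + 1)))
    (show (1 / 2 : ℝ) ∈ Icc _ _ from ⟨by rw [hLa]; linarith, by rw [hRa]; linarith⟩)
  have key : ∀ m ∈ Icc L R, (1 + m) / (Real.pi * (1 - m)) * Real.arcsin ((1 - m) / (1 + m)) +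
        ((1 + m) / (1 - m) - (2 * k + 1)) = 1 / 2 →
      (2 * k + 3 / 2) * Real.pi * Real.sin (Real.arcsin ((1 - m) / (1 + m)))
        - Real.arcsin ((1 - m) / (1 + m)) = Real.pi := by
    intro m hm h
    have := (ratio_term_eq_iff (c := 1) (d := 2 * k + 3 / 2) (hsub m hm)).1 (by linarith)
    linarith
  -- Since `k ≥ 1`, `m ≥ 1 / 2` and the arcsine is at most `π / 6`; both sides of the equation now
  -- increase in `α`, so this restriction is what gives injectivity.
  have hmem : ∀ m ∈ Icc L R, Real.arcsin ((1 - m) / (1 + m)) ∈ Icc 0 (Real.pi / 3) := by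
    intro m hm
    have hI := hsub m hm
    refine ⟨(arcsin_ratio_spec hI).2.1.le, ?_⟩
    have hm2 : 1 / 2 ≤ m := by
      refine le_trans ?_ hm.1
      rw [hL, div_le_div_iff₀ two_pos (by positivity)]; linarith
    have hr : (1 - m) / (1 + m) ≤ 1 / 2 := by
      rw [div_le_div_iff₀ (by linarith) two_pos]; linarith
    have h6 : Real.arcsin (1 / 2) = Real.pi / 6 := by
      rw [← Real.sin_pi_div_six, Real.arcsin_sin] <;> linarith
    have := Real.monotone_arcsin hr
    linarith
  refine ⟨m, ⟨⟨lt_of_le_of_ne hm.1 ?_, lt_of_le_of_ne hm.2 ?_⟩, ?_⟩, ?_⟩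
  · rintro rfl
    simp only [hLa] at hme
    linarith
  · rintro rfl
    simp only [hRa] at hme
    linarith
  · linarith
  · rintro m' ⟨hm', hme'⟩
    have hm'' : m' ∈ Icc L R := ⟨hm'.1.le, hm'.2.le⟩
    refine eq_of_arcsin_ratio_eq (hsub m' hm'') (hsub m hm) ?_
    refine (strictMonoOn_mul_sin_sub (c := (2 * k + 3 / 2) * Real.pi) (by nlinarith)).injOn
      (hmem m' hm'') (hmem m hm) ?_
    rw [key m' hm'' hme', key m hm (by linarith)]

/-! ### Transfer to `p₁` and to `m > 1` by `m ↦ 1 / m`. -/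

lemma existsUnique_inv {P : ℝ → Prop} {Q : ℝ → Prop} (h : ∃! m, Q m)
    (hPQ : ∀ m, P m ↔ Q (1 / m)) : ∃! m, P m := by
  obtain ⟨m, hm, hu⟩ := h
  refine ⟨1 / m, (hPQ _).2 (by rwa [one_div_one_div]), fun m' hm' => ?_⟩
  rw [← hu _ ((hPQ _).1 hm'), one_div_one_div]

lemma one_div_mem_Ioo_iff {a b c d m : ℝ} (ha : 0 < a) (hb : 0 < b) (hc : 0 < c) (hd : 0 < d) :
    1 / m ∈ Ioo (a / b) (c / d) ↔ m ∈ Ioo (d / c) (b / a) := by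
  rw [← one_div_div c d, ← one_div_div a b]
  have h1 : 0 < c / d := by positivity
  have h2 : 0 < a / b := by positivity
  constructor
  · rintro ⟨h3, h4⟩
    have hm : 0 < 1 / m := h2.trans h3
    have hm' : 0 < m := one_div_pos.1 hm
    exact ⟨(one_div_lt h1 hm').2 h4, (lt_one_div hm' h2).2 h3⟩
  · rintro ⟨h3, h4⟩
    have hm : 0 < m := (one_div_pos.2 h1).trans h3
    exact ⟨(lt_one_div hm h2).1 h4, (one_div_lt h1 hm).1 h3⟩

lemma p₁_eq_mul_iff {m y : ℝ} (hm : m ∈ Ioo (0 : ℝ) 1) :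
    p₁ m = m * y ↔ xRoot m = y := by
  rw [p₁_of_lt_one hm, mul_right_inj' hm.1.ne']

lemma one_div_mem_lower_iff {k : ℕ} (hk : 1 ≤ k) {m : ℝ} :
    1 / m ∈ Ioo ((2 * (k : ℝ) - 1) / (2 * k + 1)) ((k : ℝ) / (k + 1)) ↔
      m ∈ Ioo (((k : ℝ) + 1) / k) ((2 * (k : ℝ) + 1) / (2 * k - 1)) := by
  have hk' : (1 : ℝ) ≤ k := by exact_mod_cast hk
  exact one_div_mem_Ioo_iff (by linarith) (by linarith) (by linarith) (by linarith)

lemma one_div_mem_upper_iff {k : ℕ} (hk : 1 ≤ k) {m : ℝ} :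
    1 / m ∈ Ioo ((k : ℝ) / (k + 1)) ((2 * (k : ℝ) + 1) / (2 * k + 3)) ↔
      m ∈ Ioo ((2 * (k : ℝ) + 3) / (2 * k + 1)) (((k : ℝ) + 1) / k) := by
  have hk' : (1 : ℝ) ≤ k := by exact_mod_cast hk
  exact one_div_mem_Ioo_iff (by linarith) (by linarith) (by linarith) (by linarith)

lemma one_lt_of_one_div_mem {m : ℝ} (h : 1 / m ∈ Ioo (0 : ℝ) 1) : 1 < m := by
  have hm : 0 < m := one_div_pos.1 h.1
  have := h.2
  rwa [div_lt_one hm] at this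

lemma pi_mul_div_sub_one {m : ℝ} (hm : m ≠ 0) :
    Real.pi * m / (m - 1) = Real.pi / (1 - 1 / m) := by
  rw [one_sub_div hm, div_div_eq_mul_div]

lemma pi_mul_div_one_add {m : ℝ} (hm : m ≠ 0) :
    Real.pi * m / (1 + m) = Real.pi / (1 + 1 / m) := by
  rw [one_add_div hm, div_div_eq_mul_div, add_comm]

lemma p₁_bounds_lower {k : ℕ} (hk : 1 ≤ k) :
    (∀ m ∈ Ioo ((2 * (k : ℝ) - 1) / (2 * k + 1)) ((k : ℝ) / (k + 1)),
        Real.pi * m / (1 - m) - Real.pi * m / (1 + m) * h₁ k m ≤ p₁ m) ∧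
      (∃! m : ℝ, m ∈ Ioo ((2 * (k : ℝ) - 1) / (2 * k + 1)) ((k : ℝ) / (k + 1)) ∧
        p₁ m = Real.pi * m / (1 - m) - Real.pi * m / (1 + m) * h₁ k m) := by
  have e : ∀ m : ℝ, Real.pi * m / (1 - m) - Real.pi * m / (1 + m) * h₁ k m =
      m * (Real.pi / (1 - m) - Real.pi / (1 + m) * h₁ k m) := fun m => by ring
  refine ⟨fun m hm => ?_, (existsUnique_congr fun m => ?_).1 (existsUnique_lower hk)⟩
  · have hI := (mem_lower_interval hk hm).1
    rw [e, p₁_of_lt_one hI]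
    exact mul_le_mul_of_nonneg_left (xRoot_lower_bound hk hm).1 hI.1.le
  · refine and_congr_right fun hm => ?_
    rw [e, p₁_eq_mul_iff (mem_lower_interval hk hm).1, (xRoot_lower_bound hk hm).2]

lemma p₁_bounds_upper {k : ℕ} (hk : 1 ≤ k) :
    (∀ m ∈ Ioo ((k : ℝ) / (k + 1)) ((2 * (k : ℝ) + 1) / (2 * k + 3)),
        p₁ m ≤ Real.pi * m / (1 - m) + Real.pi * m / (1 + m) * h₂ k m) ∧
      (∃! m : ℝ, m ∈ Ioo ((k : ℝ) / (k + 1)) ((2 * (k : ℝ) + 1) / (2 * k + 3)) ∧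
        p₁ m = Real.pi * m / (1 - m) + Real.pi * m / (1 + m) * h₂ k m) := by
  have e : ∀ m : ℝ, Real.pi * m / (1 - m) + Real.pi * m / (1 + m) * h₂ k m =
      m * (Real.pi / (1 - m) + Real.pi / (1 + m) * h₂ k m) := fun m => by ring
  refine ⟨fun m hm => ?_, (existsUnique_congr fun m => ?_).1 (existsUnique_upper hk)⟩
  · have hI := (mem_upper_interval hm).1
    rw [e, p₁_of_lt_one hI]
    exact mul_le_mul_of_nonneg_left (xRoot_upper_bound hk hm).1 hI.1.le
  · refine and_congr_right fun hm => ?_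
    rw [e, p₁_eq_mul_iff (mem_upper_interval hm).1, (xRoot_upper_bound hk hm).2]

lemma p₁_bounds_upper_inv {k : ℕ} (hk : 1 ≤ k) :
    (∀ m ∈ Ioo ((2 * (k : ℝ) + 3) / (2 * k + 1)) (((k : ℝ) + 1) / k),
        p₁ m ≤ Real.pi * m / (m - 1) + Real.pi * m / (1 + m) * h₂ k (1 / m)) ∧
      (∃! m : ℝ, m ∈ Ioo ((2 * (k : ℝ) + 3) / (2 * k + 1)) (((k : ℝ) + 1) / k) ∧
        p₁ m = Real.pi * m / (m - 1) + Real.pi * m / (1 + m) * h₂ k (1 / m)) := by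
  refine ⟨fun m hm => ?_, existsUnique_inv (existsUnique_upper hk) fun m => ?_⟩
  · have hm' := (one_div_mem_upper_iff hk).2 hm
    have h1 := one_lt_of_one_div_mem (mem_upper_interval hm').1
    have h0 : m ≠ 0 := by linarith
    rw [p₁_of_one_lt h1, pi_mul_div_sub_one h0, pi_mul_div_one_add h0]
    exact (xRoot_upper_bound hk hm').1
  · rw [one_div_mem_upper_iff hk]
    refine and_congr_right fun hm => ?_
    have hm' := (one_div_mem_upper_iff hk).2 hm
    have h1 := one_lt_of_one_div_mem (mem_upper_interval hm').1
    have h0 : m ≠ 0 := by linarith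
    rw [p₁_of_one_lt h1, pi_mul_div_sub_one h0, pi_mul_div_one_add h0,
      (xRoot_upper_bound hk hm').2]

lemma p₁_bounds_lower_inv {k : ℕ} (hk : 1 ≤ k) :
    (∀ m ∈ Ioo (((k : ℝ) + 1) / k) ((2 * (k : ℝ) + 1) / (2 * k - 1)),
        Real.pi * m / (m - 1) - Real.pi * m / (1 + m) * h₁ k (1 / m) ≤ p₁ m) ∧
      (∃! m : ℝ, m ∈ Ioo (((k : ℝ) + 1) / k) ((2 * (k : ℝ) + 1) / (2 * k - 1)) ∧
        p₁ m = Real.pi * m / (m - 1) - Real.pi * m / (1 + m) * h₁ k (1 / m)) := by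
  refine ⟨fun m hm => ?_, existsUnique_inv (existsUnique_lower hk) fun m => ?_⟩
  · have hm' := (one_div_mem_lower_iff hk).2 hm
    have h1 := one_lt_of_one_div_mem (mem_lower_interval hk hm').1
    have h0 : m ≠ 0 := by linarith
    rw [p₁_of_one_lt h1, pi_mul_div_sub_one h0, pi_mul_div_one_add h0]
    exact (xRoot_lower_bound hk hm').1
  · rw [one_div_mem_lower_iff hk]
    refine and_congr_right fun hm => ?_
    have hm' := (one_div_mem_lower_iff hk).2 hm
    have h1 := one_lt_of_one_div_mem (mem_lower_interval hk hm').1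
    have h0 : m ≠ 0 := by linarith
    rw [p₁_of_one_lt h1, pi_mul_div_sub_one h0, pi_mul_div_one_add h0,
      (xRoot_lower_bound hk hm').2]

lemma p₁_comparison {k : ℕ} (hk : 1 ≤ k) :
    (∀ m ∈ Ioo ((2 * (k : ℝ) - 1) / (2 * k + 1)) ((k : ℝ) / (k + 1)),
        p₁ m < Real.pi * m / (1 - m)) ∧
      (∀ m ∈ Ioo ((k : ℝ) / (k + 1)) ((2 * (k : ℝ) + 1) / (2 * k + 3)),
        Real.pi * m / (1 - m) < p₁ m) ∧
      (∀ m ∈ Ioo ((2 * (k : ℝ) + 3) / (2 * k + 1)) (((k : ℝ) + 1) / k),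
        Real.pi * m / (m - 1) < p₁ m) ∧
      (∀ m ∈ Ioo (((k : ℝ) + 1) / k) ((2 * (k : ℝ) + 1) / (2 * k - 1)),
        p₁ m < Real.pi * m / (m - 1)) := by
  refine ⟨fun m hm => ?_, fun m hm => ?_, fun m hm => ?_, fun m hm => ?_⟩
  · have hI := (mem_lower_interval hk hm).1
    rw [p₁_of_lt_one hI, mul_comm Real.pi, mul_div_assoc]
    exact mul_lt_mul_of_pos_left (xRoot_lt_pi_div_of_lower hk hm) hI.1
  · obtain ⟨hI, h1, h2⟩ := mem_upper_interval hm
    rw [p₁_of_lt_one hI, mul_comm Real.pi, mul_div_assoc]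
    exact mul_lt_mul_of_pos_left (pi_div_lt_xRoot_of_upper hI h1 h2) hI.1
  · obtain ⟨hI, h1, h2⟩ := mem_upper_interval ((one_div_mem_upper_iff hk).2 hm)
    have hm1 := one_lt_of_one_div_mem hI
    rw [p₁_of_one_lt hm1, pi_mul_div_sub_one (by linarith)]
    exact pi_div_lt_xRoot_of_upper hI h1 h2
  · have hm' := (one_div_mem_lower_iff hk).2 hm
    have hm1 := one_lt_of_one_div_mem (mem_lower_interval hk hm').1
    rw [p₁_of_one_lt hm1, pi_mul_div_sub_one (by linarith)]
    exact xRoot_lt_pi_div_of_lower hk hm'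

lemma p₁_div_add_two {k : ℕ} (hk : 1 ≤ k) :
    p₁ ((k : ℝ) / (k + 2)) = Real.pi * ((k : ℝ) / (k + 2)) / (1 - (k : ℝ) / (k + 2)) := by
  rw [p₁_of_lt_one (div_add_mem_Ioo hk two_pos), xRoot_div_add_two hk]
  ring

lemma p₁_add_two_div {k : ℕ} (hk : 1 ≤ k) :
    p₁ (((k : ℝ) + 2) / k) = Real.pi * (((k : ℝ) + 2) / k) / (((k : ℝ) + 2) / k - 1) := by
  have hI : (k : ℝ) / (k + 2) ∈ Ioo (0 : ℝ) 1 := div_add_mem_Ioo hk two_pos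
  have hm : 1 < ((k : ℝ) + 2) / k := one_lt_of_one_div_mem (by rw [one_div_div]; exact hI)
  rw [p₁_of_one_lt hm, pi_mul_div_sub_one (by linarith), one_div_div, xRoot_div_add_two hk]

lemma p₁_bounds_of_lt_third {m ρ : ℝ} (hm : m ∈ Ioo (0 : ℝ) (1 / 3))
    (hρ : ρ ∈ Ioo Real.pi (3 * Real.pi / 2)) (h : Real.sin ρ - ρ * Real.cos ρ = 0) :
    max (ρ * m) (Real.pi * m / (1 - m)) < p₁ m ∧ p₁ m < 3 * Real.pi * m / 2 := by
  obtain ⟨h1, h2, h3⟩ := xRoot_bounds_of_lt_third hm hρ h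
  have h0 := hm.1
  rw [p₁_of_lt_one ⟨h0, by linarith [hm.2]⟩]
  refine ⟨max_lt ?_ ?_, ?_⟩
  · rw [mul_comm]; gcongr
  · rw [mul_comm Real.pi, mul_div_assoc]; gcongr
  · rw [show 3 * Real.pi * m / 2 = m * (3 * Real.pi / 2) by ring]; gcongr

lemma p₁_bounds_of_three_lt {m ρ : ℝ} (hm : 3 < m)
    (hρ : ρ ∈ Ioo Real.pi (3 * Real.pi / 2)) (h : Real.sin ρ - ρ * Real.cos ρ = 0) :
    max ρ (Real.pi * m / (m - 1)) < p₁ m ∧ p₁ m < 3 * Real.pi / 2 := by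
  obtain ⟨h1, h2, h3⟩ := xRoot_bounds_of_lt_third
    ⟨one_div_pos.2 (by linarith), one_div_lt_one_div_of_lt three_pos hm⟩ hρ h
  rw [p₁_of_one_lt (by linarith), pi_mul_div_sub_one (by linarith)]
  exact ⟨max_lt h1 h2, h3⟩

/-! ### The main theorem. -/

theorem theorem1 :
    -- existence of the minimal positive root, and the functional equation
    (∀ m : ℝ, m ∈ Ioo 0 1 ∪ Ioi 1 → IsLeast (posRoots m) (p₁ m) ∧ p₁ m = m * p₁ (1 / m)) ∧
    -- (a)
    (ContinuousOn p₁ (Ioo 0 1) ∧ StrictMonoOn p₁ (Ioo 0 1) ∧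
      (∀ k : ℕ, 1 ≤ k → ∀ m : ℝ, m = (k : ℝ) / (k + 2) → p₁ m = Real.pi * m / (1 - m)) ∧
      ContinuousOn p₁ (Ioi 1) ∧ StrictAntiOn p₁ (Ioi 1) ∧
      (∀ k : ℕ, 1 ≤ k → ∀ m : ℝ, m = ((k : ℝ) + 2) / k → p₁ m = Real.pi * m / (m - 1))) ∧
    -- (b)
    ((∀ m ∈ Ioo (0 : ℝ) 1, (∀ k : ℕ, 1 ≤ k → m ≠ (k : ℝ) / (k + 1)) → ContDiffAt ℝ 1 p₁ m) ∧
      (∀ k : ℕ, 1 ≤ k → ∀ m : ℝ, m = (k : ℝ) / (k + 1) → Tendsto (slope p₁ m) (𝓝[≠] m) atTop) ∧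
      (∀ m ∈ Ioi (1 : ℝ), (∀ k : ℕ, 1 ≤ k → m ≠ ((k : ℝ) + 1) / k) → ContDiffAt ℝ 1 p₁ m) ∧
      (∀ k : ℕ, 1 ≤ k → ∀ m : ℝ, m = ((k : ℝ) + 1) / k →
        Tendsto (slope p₁ m) (𝓝[≠] m) atBot)) ∧
    -- (c)
    (∀ k : ℕ, 1 ≤ k →
      (∀ m ∈ Ioo ((2 * (k : ℝ) - 1) / (2 * k + 1)) ((k : ℝ) / (k + 1)),
        p₁ m < Real.pi * m / (1 - m)) ∧
      (∀ m ∈ Ioo ((k : ℝ) / (k + 1)) ((2 * (k : ℝ) + 1) / (2 * k + 3)),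
        Real.pi * m / (1 - m) < p₁ m) ∧
      (∀ m ∈ Ioo ((2 * (k : ℝ) + 3) / (2 * k + 1)) (((k : ℝ) + 1) / k),
        Real.pi * m / (m - 1) < p₁ m) ∧
      (∀ m ∈ Ioo (((k : ℝ) + 1) / k) ((2 * (k : ℝ) + 1) / (2 * k - 1)),
        p₁ m < Real.pi * m / (m - 1))) ∧
    -- (d): each bound is strict except at exactly one point of its interval
    (∀ k : ℕ, 1 ≤ k →
      ((∀ m ∈ Ioo ((2 * (k : ℝ) - 1) / (2 * k + 1)) ((k : ℝ) / (k + 1)),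
          Real.pi * m / (1 - m) - Real.pi * m / (1 + m) * h₁ k m ≤ p₁ m) ∧
        (∃! m : ℝ, m ∈ Ioo ((2 * (k : ℝ) - 1) / (2 * k + 1)) ((k : ℝ) / (k + 1)) ∧
          p₁ m = Real.pi * m / (1 - m) - Real.pi * m / (1 + m) * h₁ k m)) ∧
      ((∀ m ∈ Ioo ((k : ℝ) / (k + 1)) ((2 * (k : ℝ) + 1) / (2 * k + 3)),
          p₁ m ≤ Real.pi * m / (1 - m) + Real.pi * m / (1 + m) * h₂ k m) ∧
        (∃! m : ℝ, m ∈ Ioo ((k : ℝ) / (k + 1)) ((2 * (k : ℝ) + 1) / (2 * k + 3)) ∧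
          p₁ m = Real.pi * m / (1 - m) + Real.pi * m / (1 + m) * h₂ k m)) ∧
      ((∀ m ∈ Ioo ((2 * (k : ℝ) + 3) / (2 * k + 1)) (((k : ℝ) + 1) / k),
          p₁ m ≤ Real.pi * m / (m - 1) + Real.pi * m / (1 + m) * h₂ k (1 / m)) ∧
        (∃! m : ℝ, m ∈ Ioo ((2 * (k : ℝ) + 3) / (2 * k + 1)) (((k : ℝ) + 1) / k) ∧
          p₁ m = Real.pi * m / (m - 1) + Real.pi * m / (1 + m) * h₂ k (1 / m))) ∧
      ((∀ m ∈ Ioo (((k : ℝ) + 1) / k) ((2 * (k : ℝ) + 1) / (2 * k - 1)),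
          Real.pi * m / (m - 1) - Real.pi * m / (1 + m) * h₁ k (1 / m) ≤ p₁ m) ∧
        (∃! m : ℝ, m ∈ Ioo (((k : ℝ) + 1) / k) ((2 * (k : ℝ) + 1) / (2 * k - 1)) ∧
          p₁ m = Real.pi * m / (m - 1) - Real.pi * m / (1 + m) * h₁ k (1 / m)))) ∧
    -- (e)
    (∃ ρ : ℝ, (ρ ∈ Ioo Real.pi (3 * Real.pi / 2) ∧ Real.tan ρ = ρ) ∧
      (∀ x ∈ Ioo Real.pi (3 * Real.pi / 2), Real.tan x = x → x = ρ) ∧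
      (4.493409 ≤ ρ ∧ ρ < 4.493410) ∧
      (∀ m ∈ Ioo (0 : ℝ) (1 / 3),
        max (ρ * m) (Real.pi * m / (1 - m)) < p₁ m ∧ p₁ m < 3 * Real.pi * m / 2) ∧
      (∀ m ∈ Ioi (3 : ℝ),
        max ρ (Real.pi * m / (m - 1)) < p₁ m ∧ p₁ m < 3 * Real.pi / 2)) ∧
    -- (f)
    (∀ m : ℝ, m ∈ Ioo 0 1 ∪ Ioi 1 → ChangesSignAt (fun p => g₁ p m) (p₁ m)) := by

  refine ⟨fun m hm => exists_isLeast_and_reflection hm,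
    ⟨continuousOn_p₁_lt_one, strictMonoOn_p₁, ?_, continuousOn_p₁_one_lt, strictAntiOn_p₁, ?_⟩,
    ⟨fun m hm h => contDiffAt_p₁_lt_one hm h, ?_, fun m hm h => contDiffAt_p₁_one_lt hm h, ?_⟩,
    fun k hk => p₁_comparison hk,
    fun k hk => ⟨p₁_bounds_lower hk, p₁_bounds_upper hk, p₁_bounds_upper_inv hk,
      p₁_bounds_lower_inv hk⟩, ?_, fun m hm => changesSignAt_g₁ hm⟩
  · rintro k hk _ rfl
    exact p₁_div_add_two hk
  · rintro k hk _ rfl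
    exact p₁_add_two_div hk
  · rintro k hk _ rfl
    exact tendsto_slope_p₁_lt_one hk
  · rintro k hk _ rfl
    exact tendsto_slope_p₁_one_lt hk
  · obtain ⟨ρ, hρ, h0, hb⟩ := exists_tan_eq_self
    refine ⟨ρ, ⟨hρ, (tan_eq_self_iff hρ).2 h0⟩, fun x hx hxt => ?_, hb,
      fun m hm => p₁_bounds_of_lt_third hm hρ h0, fun m hm => p₁_bounds_of_three_lt hm hρ h0⟩
    exact strictAntiOn_sin_sub_mul_cos.injOn (Ioo_subset_Icc_self hx) (Ioo_subset_Icc_self hρ)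
      (((tan_eq_self_iff hx).1 hxt).trans h0.symm)
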